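/- Let $p$ be a prime number, let $n<p-1$ be a natural number, and let $(A,+)$ be an abelian group of cardinality $p^n$. A brace with additive group $(A,+)$ is a group operation $\circ$ on the set $A$ with $a\circ(b+c)+a=a\circ b+a\circ c$ for all $a,b,c\in A$; put $a*b=a\circ b-a-b$. Let $\mathrm{ann}(p^2)=\{a\in A:p^2a=0\}$, and let $[a]$ be the coset of $a$ in $A/\mathrm{ann}(p^2)$. For $u\in pA$ let $\wp^{-1}(u)$ be a chosen element of $A$ with $p\,\wp^{-1}(u)=u$. Let $\gamma$ be a primitive root modulo $p^p$ and $\xi=\gamma^{p^{p-1}}$. For a brace with additive group $(A,+)$ define operations on $A/\mathrm{ann}(p^2)$ by $$[a]\odot[c]=[\wp^{-1}((pa)*c)],\qquad [a]\bullet[c]=\sum_{i=0}^{p-2}\xi^{p-1-i}\,\bigl([\xi^i a]\odot[c]\bigr).$$ Let $V$ be the set of all non-associative words in the non-commuting variables $X,Y$ in which $Y$ appears exactly once, at the end of the word, and $X$ appears at least twice. Then there are integers $\alpha_w$ ($w\in V$), only finitely many of them non-zero and depending only on the additive group $(A,+)$, such that for each brace $(A,+,\circ)$ with additive group $(A,+)$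 the following holds: the operation $\odot$ is well defined (that is, $(pa)*c\in pA$ for all $a,c\in A$, and $[\wp^{-1}((pa)*c)]$ depends neither on the choice of $\wp^{-1}$ nor on the representatives $a,c$ of the two cosets), and for all $a,c\in A$ $$[a]\odot[c]=-(1+p+p^2+\cdots+p^{p-1})\,\bigl([a]\bullet[c]\bigr)+p\sum_{w\in V}\alpha_w\,w([a],[c]),$$ where $w([a],[c])$ is the value of the word $w$ at $X=[a]$, $Y=[c]$ with multiplication $\bullet$. -/

import Mathlib

/-- A (left) brace with additive group `(A, +)`: a group operation `∘` on `A` such that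
`a ∘ (b + c) + a = a ∘ b + a ∘ c`. -/
structure LeftBrace (A : Type*) [AddCommGroup A] where
  /-- the group structure `(A, ∘)` -/
  group : Group A
  distrib : ∀ a b c : A,
    group.mul a (b + c) + a = group.mul a b + group.mul a c

/-- The operation `a * b = a ∘ b - a - b` of a brace. -/
def LeftBrace.star {A : Type*} [AddCommGroup A] (B : LeftBrace A) (a b : A) : A :=
  B.group.mul a b - a - b

/-- `ann(m)`, the subgroup of all `a` with `m a = 0`. -/
def ann (A : Type*) [AddCommGroup A] (m : ℕ) : AddSubgroup A :=
  (nsmulAddMonoidHom (α := A) m).ker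

open Classical in
/-- `℘⁻¹ : pA → A`, a choice of an element with `p ℘⁻¹(a) = a` for `a ∈ pA` (and the value `0`
outside `pA`). It depends only on the additive group. -/
noncomputable def pInv {A : Type*} [AddCommGroup A] (p : ℕ) (a : A) : A :=
  if h : ∃ z : A, p • z = a then h.choose else 0

/-- The operation `[x] ⊙ [y] = [℘⁻¹((p x) * y)]` on `A / ann(p ^ 2)`, computed on chosen
representatives of the two cosets. -/
noncomputable def LeftBrace.odot {A : Type*} [AddCommGroup A] (B : LeftBrace A) (p : ℕ)
    (x y : A ⧸ ann A (p ^ 2)) : A ⧸ ann A (p ^ 2) :=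
  QuotientAddGroup.mk (pInv p (B.star (p • Quotient.out x) (Quotient.out y)))

/-- The operation `x • y = ∑_{i = 0}^{p - 2} ξ ^ (p - 1 - i) ((ξ ^ i x) ⊙ y)` on
`A / ann(p ^ 2)`, where `ξ = γ ^ (p ^ (p - 1))`. -/
noncomputable def LeftBrace.bullet {A : Type*} [AddCommGroup A] (B : LeftBrace A) (p : ℕ) (γ : ℤ)
    (x y : A ⧸ ann A (p ^ 2)) : A ⧸ ann A (p ^ 2) :=
  ∑ i ∈ Finset.range (p - 1),
    ((γ ^ (p ^ (p - 1))) ^ (p - 1 - i)) • B.odot p (((γ ^ (p ^ (p - 1))) ^ i) • x) y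

/-- The two variables `X`, `Y`. -/
inductive Letter
  | X
  | Y

/-- The number of occurrences of `X` in a non-associative word. -/
def countX : FreeMagma Letter → ℕ
  | .of .X => 1
  | .of .Y => 0
  | .mul u v => countX u + countX v

/-- The number of occurrences of `Y` in a non-associative word. -/
def countY : FreeMagma Letter → ℕ
  | .of .X => 0
  | .of .Y => 1
  | .mul u v => countY u + countY v

/-- The last letter of a non-associative word. -/
def lastLetter : FreeMagma Letter → Letter
  | .of l => l
  | .mul _ v => lastLetter v

/-- The set `V` of all non-associative words in `X`, `Y` in which `Y` appears exactly once, at the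
end of the word, and `X` appears at least twice. -/
def wordsV : Set (FreeMagma Letter) :=
  {w | 2 ≤ countX w ∧ countY w = 1 ∧ lastLetter w = Letter.Y}

/-- The value of a non-associative word at `X = x`, `Y = y` for the binary operation `op`. -/
def evalWord {Q : Type*} (op : Q → Q → Q) (x y : Q) : FreeMagma Letter → Q
  | .of .X => x
  | .of .Y => y
  | .mul u v => op (evalWord op x y u) (evalWord op x y v)

/-! A brace is linearised by its affine maps `v ↦ λ_b v + b`, acting on `A × ℤ`. Since `(A,∘)` is a
`p`-group, these are unipotent for a filtration of length less than `p`, so the exponential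
truncated before degree `p`, with factorials inverted modulo a power of `p`, has logarithms. The
logarithms are closed under addition (`truncExp_add_mem`); this replaces the
Baker–Campbell–Hausdorff formula. Evaluation at `(0, 1)` identifies them additively with `A`, which
gives a biadditive operation `M` on `A` from which `∘` is recovered by exponential series
(`LeftBrace.exists_flow`).

At a multiple `p a` the series rescale: modulo `ann(p^2)` one has `a = v + c₂ p M_v v + ⋯` and `a ⊙
y = M_v y + c₂ p M_v^2 y + ⋯`. Inverting the first series and substituting writes `a ⊙ y` as `M_a y`
plus words of degree `d ≥ 2` in `a`, with coefficients divisible by `p^(d-1)` (`exists_coeff`).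
Running this once in a product over all operations and arguments makes the coefficients independent
of the brace (`exists_uniform_coeff`).

The sum over powers of `ξ` defining `•` multiplies degree `1` by `p - 1` and kills degrees `2, …, p
- 1` (`dvd_averageWeight`); degrees from `p` on vanish because `p^(p-1)` annihilates `A`. Hence `•`
is `(p - 1) M`. As `-(1 + p + ⋯ + p^(p-1))` inverts `p - 1` modulo `p^p`, `M` can be replaced by a
multiple of `•`, which gives the formula. -/

open Finset

/-! ### Truncated exponentials and logarithms in a filtered ring -/

/-- Integers inverting the factorials `i!`, `i < p`, modulo `p ^ N`. -/
structure InvFactorial (p N : ℕ) (c : ℕ → ℤ) : Prop where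
  zero : c 0 = 1
  one : c 1 = 1
  mul : ∀ i < p, ((p : ℤ) ^ N) ∣ (i.factorial : ℤ) * c i - 1

theorem isCoprime_factorial {p : ℕ} (hp : p.Prime) (N : ℕ) {i : ℕ} (hi : i < p) :
    IsCoprime ((p : ℤ) ^ N) (i.factorial : ℤ) := by
  have h : Nat.Coprime (p ^ N) i.factorial :=
    Nat.Coprime.pow_left _ (hp.coprime_factorial_of_lt hi)
  exact_mod_cast Nat.isCoprime_iff_coprime.mpr h

theorem exists_invFactorial {p : ℕ} (hp : p.Prime) (N : ℕ) : ∃ c, InvFactorial p N c := by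
  have h : ∀ i : ℕ, ∃ x : ℤ, i < p → ((p : ℤ) ^ N) ∣ (i.factorial : ℤ) * x - 1 := by
    intro i
    by_cases hi : i < p
    · obtain ⟨a, b, hab⟩ := isCoprime_factorial hp N hi
      exact ⟨b, fun _ => ⟨-a, by linear_combination hab⟩⟩
    · exact ⟨0, fun h => absurd h hi⟩
  choose c hc using h
  refine ⟨fun i => if i ≤ 1 then 1 else c i, by simp, by simp, fun i hi => ?_⟩
  by_cases h1 : i ≤ 1
  · interval_cases i <;> simp
  · simpa [h1] using hc i hi

/-- A filtration of a ring by additive subgroups that ends before `p` and whose first term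
is `p ^ N`-torsion. -/
structure NilFiltration {R : Type*} [Ring R] (p N : ℕ) (F : ℕ → AddSubgroup R) : Prop where
  anti : Antitone F
  one_mem : (1 : R) ∈ F 0
  mul_mem : ∀ {i j x y}, x ∈ F i → y ∈ F j → x * y ∈ F (i + j)
  bot : F p = ⊥
  tors : ∀ {x}, x ∈ F 1 → ((p : ℤ) ^ N) • x = 0

/-- The exponential series, truncated before degree `p`. -/
def truncExp {R : Type*} [Ring R] (p : ℕ) (c : ℕ → ℤ) (x : R) : R :=
  ∑ i ∈ range p, c i • x ^ i

section

variable {R : Type*} [Ring R] {p N : ℕ} {F : ℕ → AddSubgroup R} {c : ℕ → ℤ}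

theorem NilFiltration.pow_mem (hF : NilFiltration p N F) {k : ℕ} {x : R} (hx : x ∈ F k) (i : ℕ) :
    x ^ i ∈ F (k * i) := by
  induction i with
  | zero => simpa using hF.one_mem
  | succ i ih => rw [pow_succ, mul_add, mul_one]; exact hF.mul_mem ih hx

theorem NilFiltration.eq_zero (hF : NilFiltration p N F) {k : ℕ} (hk : p ≤ k) {x : R}
    (hx : x ∈ F k) : x = 0 := by
  have := hF.anti hk hx
  rwa [hF.bot, AddSubgroup.mem_bot] at this

theorem NilFiltration.zsmul_congr (hF : NilFiltration p N F) {x : R} (hx : x ∈ F 1) {a b : ℤ}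
    (h : ((p : ℤ) ^ N) ∣ a - b) : a • x = b • x := by
  obtain ⟨t, ht⟩ := h
  rw [← sub_eq_zero, ← sub_smul, ht, mul_comm, mul_smul, hF.tors hx, smul_zero]

/-- The usual binomial computation. Terms of total degree at least `p` vanish by the filtration, and
below `p` the identity `c (i+j) * choose = c i * c j` holds modulo `p ^ N`. Degree `0` is treated
apart because `1` need not be torsion, which is why `c 0 = 1` is required exactly. -/
theorem truncExp_add (hp : p.Prime) (hF : NilFiltration p N F) (hc : InvFactorial p N c) {x y : R}
    (hx : x ∈ F 1) (hy : y ∈ F 1) (hxy : Commute x y) :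
    truncExp p c (x + y) = truncExp p c x * truncExp p c y := by
  have hmem : ∀ i j, x ^ i * y ^ j ∈ F (i + j) := fun i j =>
    hF.mul_mem (by simpa using hF.pow_mem hx i) (by simpa using hF.pow_mem hy j)
  have hterm : ∀ i j, i + j < p →
      (c (i + j) * ((i + j).choose i : ℤ)) • (x ^ i * y ^ j) = (c i * c j) • (x ^ i * y ^ j) := by
    intro i j hij
    rcases Nat.eq_zero_or_pos (i + j) with h0 | h0
    · obtain ⟨rfl, rfl⟩ : i = 0 ∧ j = 0 := by omega
      simp [hc.zero]
    · refine hF.zsmul_congr (hF.anti h0 (hmem i j)) ?_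
      have hi := hc.mul i (by omega)
      have hj := hc.mul j (by omega)
      have hk := hc.mul (i + j) hij
      have hch : ((i + j).choose i : ℤ) * i.factorial * j.factorial = (i + j).factorial := by
        rw [Nat.choose_symm_add]
        exact_mod_cast Nat.add_choose_mul_factorial_mul_factorial i j
      have hcop : IsCoprime ((p : ℤ) ^ N) ((i.factorial : ℤ) * j.factorial) :=
        (isCoprime_factorial hp N (by omega)).mul_right (isCoprime_factorial hp N (by omega))
      refine hcop.dvd_of_dvd_mul_left ?_
      have : (i.factorial : ℤ) * j.factorial * (c (i + j) * ((i + j).choose i : ℤ) - c i * c j)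
          = ((i + j).factorial * c (i + j) - 1) - (i.factorial * c i - 1) * (j.factorial * c j)
            - (j.factorial * c j - 1) := by
        rw [← hch]; ring
      rw [this]
      exact ((hk.sub (hi.mul_right _)).sub hj)
  have hR : truncExp p c x * truncExp p c y
      = ∑ m ∈ range p, ∑ k ∈ range (p - m), (c m * c k) • (x ^ m * y ^ k) := by
    rw [truncExp, truncExp, Finset.sum_mul_sum]
    refine sum_congr rfl fun i hi => ?_
    symm
    have hsub : range (p - i) ⊆ range p := range_subset_range.mpr (Nat.sub_le _ _)
    rw [Finset.sum_subset hsub]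
    · refine sum_congr rfl fun j _ => ?_
      rw [smul_mul_smul_comm]
    · intro j _ hj
      rw [hF.eq_zero (by simp at hj; omega) (hmem i j), smul_zero]
  rw [hR, ← Finset.sum_range_diag_flip p (fun i j => (c i * c j) • (x ^ i * y ^ j)), truncExp]
  refine sum_congr rfl fun m hm => ?_
  rw [hxy.add_pow, Finset.smul_sum]
  refine sum_congr rfl fun k hk => ?_
  have hk' : k + (m - k) = m := by simp at hk; omega
  have := hterm k (m - k) (by simp at hm; omega)
  rw [hk'] at this
  rw [← this, mul_smul, ← nsmul_eq_mul', natCast_zsmul]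

theorem truncExp_zero (hp : p.Prime) (hc : InvFactorial p N c) : truncExp p c (0 : R) = 1 := by
  rw [truncExp, sum_eq_single 0]
  · simp [hc.zero]
  · intro i _ hi; simp [hi]
  · intro h; simp [hp.pos] at h

theorem truncExp_nsmul (hp : p.Prime) (hF : NilFiltration p N F) (hc : InvFactorial p N c) {x : R}
    (hx : x ∈ F 1) (s : ℕ) : truncExp p c (s • x) = truncExp p c x ^ s := by
  induction s with
  | zero => simp [truncExp_zero hp hc]
  | succ s ih =>
    rw [succ_nsmul, truncExp_add hp hF hc ((F 1).nsmul_mem hx s) hx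
      (Commute.smul_left (Commute.refl x) s), ih, pow_succ]

/-- `exp x = 1 + x + O(x ^ 2)`. -/
theorem truncExp_sub_mem (hp : p.Prime) (hF : NilFiltration p N F) (hc : InvFactorial p N c)
    {k : ℕ} {x : R} (hk : 1 ≤ k) (hx : x ∈ F k) : truncExp p c x - 1 - x ∈ F (k + 1) := by
  have h2 := hp.two_le
  obtain ⟨q, rfl⟩ : ∃ q, p = q + 2 := ⟨p - 2, by omega⟩
  rw [truncExp, sum_range_succ', sum_range_succ']
  have : ∑ i ∈ range q, c (i + 1 + 1) • x ^ (i + 1 + 1) + c (0 + 1) • x ^ (0 + 1) + c 0 • x ^ 0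
      - 1 - x = ∑ i ∈ range q, c (i + 1 + 1) • x ^ (i + 1 + 1) := by
    simp only [zero_add, hc.one, hc.zero, pow_one, pow_zero, one_smul]; abel
  rw [this]
  refine sum_mem fun i _ => (F _).zsmul_mem (hF.anti ?_ (hF.pow_mem hx _)) _
  nlinarith

/-- Every unipotent element is an exponential. -/
theorem exists_truncExp_eq (hp : p.Prime) (hF : NilFiltration p N F) (hc : InvFactorial p N c)
    {g : R} (hg : g - 1 ∈ F 1) : ∃ x ∈ F 1, truncExp p c x = g := by
  -- Successive approximation: the defect `d = g - exp x` is added to `x`, which pushes it one step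
  -- down the filtration. The commutation clause keeps `x` and `d` commuting, so that `exp (x + d)`
  -- factors.
  have key : ∀ j, ∃ x ∈ F 1, (∀ y, Commute y g → Commute y x) ∧ truncExp p c x - g ∈ F (j + 1) := by
    intro j
    induction j with
    | zero =>
      refine ⟨0, zero_mem _, fun y _ => Commute.zero_right y, ?_⟩
      rw [truncExp_zero hp hc]
      simpa using neg_mem hg
    | succ j ih =>
      obtain ⟨x, hx, hcom, hd⟩ := ih
      have hexp : ∀ y, Commute y x → Commute y (truncExp p c x) := fun y hy =>
        Commute.sum_right _ _ _ fun i _ => Commute.smul_right (hy.pow_right i) _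
      set d := g - truncExp p c x with hdef
      have hdm : d ∈ F (j + 1) := by simpa [hdef] using neg_mem hd
      have hd1 : d ∈ F 1 := hF.anti (by omega) hdm
      have hcomd : ∀ y, Commute y g → Commute y d := fun y hy =>
        hy.sub_right (hexp y (hcom y hy))
      refine ⟨x + d, add_mem hx hd1, fun y hy => (hcom y hy).add_right (hcomd y hy), ?_⟩
      have hxg : Commute x g := (hcom g (Commute.refl g)).symm
      rw [truncExp_add hp hF hc hx hd1 (hcomd x hxg)]
      have e1 := truncExp_sub_mem hp hF hc (by omega) hdm
      have e2 : truncExp p c x - 1 ∈ F 1 := by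
        have := add_mem (hF.anti (by omega) (truncExp_sub_mem hp hF hc le_rfl hx)) hx
        simpa using this
      have e0 : truncExp p c x ∈ F 0 := by
        have := add_mem (hF.anti (by omega : 0 ≤ 1) e2) hF.one_mem
        simpa using this
      have : truncExp p c x * truncExp p c d - g
          = truncExp p c x * (truncExp p c d - 1 - d) + (truncExp p c x - 1) * d := by
        have hgd : g = truncExp p c x + d := by simp [hdef]
        rw [hgd]; noncomm_ring
      rw [this]
      refine add_mem ?_ ?_
      · have := hF.mul_mem e0 e1
        rwa [zero_add] at this
      · have := hF.mul_mem e2 hdm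
        rwa [add_comm 1] at this
  obtain ⟨x, hx, -, h⟩ := key p
  exact ⟨x, hx, sub_eq_zero.mp (hF.eq_zero (by omega) h)⟩

/-! ### Polynomial families and closure of logarithms under addition -/

/-- The families `s ↦ ∑ s ^ i • c i` with `c i ∈ F i` and `i ≥ k`. -/
def polyFamily (F : ℕ → AddSubgroup R) (k : ℕ) : AddSubgroup (ℕ → R) :=
  AddSubgroup.closure {f | ∃ i ≥ k, ∃ a ∈ F i, f = fun s => (s ^ i) • a}

theorem polyFamily_anti : Antitone (polyFamily F) := by
  intro k l h
  refine AddSubgroup.closure_mono ?_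
  rintro f ⟨i, hi, a, ha, rfl⟩
  exact ⟨i, h.trans hi, a, ha, rfl⟩

theorem monomial_mem_polyFamily {i : ℕ} {a : R} (ha : a ∈ F i) :
    (fun s : ℕ => (s ^ i) • a) ∈ polyFamily F i :=
  AddSubgroup.subset_closure ⟨i, le_rfl, a, ha, rfl⟩

theorem one_mem_polyFamily (hF : NilFiltration p N F) : (1 : ℕ → R) ∈ polyFamily F 0 := by
  convert monomial_mem_polyFamily hF.one_mem using 1
  funext s
  simp

theorem mul_mem_polyFamily (hF : NilFiltration p N F) {k l : ℕ} {f g : ℕ → R}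
    (hf : f ∈ polyFamily F k) (hg : g ∈ polyFamily F l) : f * g ∈ polyFamily F (k + l) := by
  induction hf using AddSubgroup.closure_induction with
  | zero => simp
  | add x y _ _ hx hy => rw [add_mul]; exact add_mem hx hy
  | neg x _ hx => rw [neg_mul]; exact neg_mem hx
  | mem x hx =>
    obtain ⟨i, hi, a, ha, rfl⟩ := hx
    induction hg using AddSubgroup.closure_induction with
    | zero => simp
    | add x y _ _ hx hy => rw [mul_add]; exact add_mem hx hy
    | neg x _ hx => rw [mul_neg]; exact neg_mem hx
    | mem y hy =>
      obtain ⟨j, hj, b, hb, rfl⟩ := hy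
      refine AddSubgroup.subset_closure ⟨i + j, by omega, a * b, hF.mul_mem ha hb, ?_⟩
      funext s
      simp only [Pi.mul_apply, smul_mul_smul_comm, pow_add]

theorem polyFamily_apply_mem (hF : NilFiltration p N F) {k : ℕ} {f : ℕ → R}
    (hf : f ∈ polyFamily F k) (s : ℕ) : f s ∈ F k := by
  induction hf using AddSubgroup.closure_induction with
  | zero => exact zero_mem _
  | add x y _ _ hx hy => exact add_mem hx hy
  | neg x _ hx => exact neg_mem hx
  | mem x hx =>
    obtain ⟨i, hi, a, ha, rfl⟩ := hx
    exact (F k).nsmul_mem (hF.anti hi ha) _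

/-- Substituting `t s` for `s` multiplies the degree `k` part by `t ^ k`, while a linear exponent is
multiplied by `t`. This difference lets an error of degree `k ≥ 2` be separated from the
exponential. -/
theorem polyFamily_scale {k : ℕ} {f : ℕ → R} (hf : f ∈ polyFamily F k) (t : ℕ) :
    (fun s => f (t * s)) - (t ^ k) • f ∈ polyFamily F (k + 1) := by
  induction hf using AddSubgroup.closure_induction with
  | zero =>
    have : (fun s => (0 : ℕ → R) (t * s)) - (t ^ k) • (0 : ℕ → R) = 0 := by
      funext s
      simp
    rw [this]
    exact zero_mem _
  | add x y _ _ hx hy =>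
    convert add_mem hx hy using 1
    funext s; simp only [Pi.sub_apply, Pi.add_apply, Pi.smul_apply, smul_add]; abel
  | neg x _ hx =>
    convert neg_mem hx using 1
    funext s; simp only [Pi.sub_apply, Pi.neg_apply, Pi.smul_apply, smul_neg]; abel
  | mem x hx =>
    obtain ⟨i, hi, a, ha, rfl⟩ := hx
    rcases hi.eq_or_lt with rfl | hi
    · convert zero_mem (polyFamily F (k + 1)) using 1
      funext s
      simp [mul_pow, mul_smul]
    · have hm := polyFamily_anti (F := F) (show k + 1 ≤ i from hi) (monomial_mem_polyFamily ha)
      convert sub_mem (AddSubgroup.nsmul_mem _ hm (t ^ i)) (AddSubgroup.nsmul_mem _ hm (t ^ k))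
        using 1
      funext s
      simp [mul_pow, mul_smul]

/-- The one-parameter family `s ↦ exp (s z)`. -/
def expFamily (p : ℕ) (c : ℕ → ℤ) (z : R) : ℕ → R := fun s => truncExp p c (s • z)

theorem expFamily_sub_mem (hp : p.Prime) (hF : NilFiltration p N F) (hc : InvFactorial p N c)
    {z : R} (hz : z ∈ F 1) : expFamily p c z - 1 - (fun s : ℕ => s • z) ∈ polyFamily F 2 := by
  have h2 := hp.two_le
  obtain ⟨q, rfl⟩ : ∃ q, p = q + 2 := ⟨p - 2, by omega⟩
  have : expFamily (q + 2) c z - 1 - (fun s : ℕ => s • z)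
      = ∑ i ∈ range q, c (i + 1 + 1) • (fun s : ℕ => (s ^ (i + 1 + 1)) • z ^ (i + 1 + 1)) := by
    funext s
    simp only [Pi.sub_apply, Pi.one_apply, expFamily, truncExp, Finset.sum_apply, Pi.smul_apply]
    rw [sum_range_succ', sum_range_succ']
    simp only [zero_add, hc.one, hc.zero, pow_one, pow_zero, one_smul, smul_pow]
    abel
  rw [this]
  refine sum_mem fun i _ => AddSubgroup.zsmul_mem _ ?_ _
  refine polyFamily_anti (by omega : 2 ≤ i + 1 + 1) (monomial_mem_polyFamily ?_)
  simpa using hF.pow_mem hz (i + 1 + 1)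

theorem linear_mem_polyFamily {z : R} (hz : z ∈ F 1) :
    (fun s : ℕ => s • z) ∈ polyFamily F 1 := by
  convert monomial_mem_polyFamily hz using 1
  funext s
  simp

theorem expFamily_sub_one_mem (hp : p.Prime) (hF : NilFiltration p N F) (hc : InvFactorial p N c)
    {z : R} (hz : z ∈ F 1) : expFamily p c z - 1 ∈ polyFamily F 1 := by
  have := add_mem (polyFamily_anti (by omega : 1 ≤ 2) (expFamily_sub_mem hp hF hc hz))
    (linear_mem_polyFamily hz)
  simpa using this

theorem expFamily_add_smul (hp : p.Prime) (hF : NilFiltration p N F) (hc : InvFactorial p N c)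
    {z : R} (hz : z ∈ F 1) (a b : ℕ) :
    expFamily p c (a • z) * expFamily p c (b • z) = expFamily p c ((a + b) • z) := by
  funext s
  simp only [expFamily, Pi.mul_apply]
  rw [add_smul, smul_add, truncExp_add hp hF hc]
  · exact AddSubgroup.nsmul_mem _ (AddSubgroup.nsmul_mem _ hz _) _
  · exact AddSubgroup.nsmul_mem _ (AddSubgroup.nsmul_mem _ hz _) _
  · simp only [smul_smul]
    exact Commute.smul_left (Commute.smul_right (Commute.refl z) _) _

/-- Leading errors add under multiplication: `d` and `e` are `1` up to degree `1`, so their effect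
on `a` and `b` has degree above `k`, and `a * b` has degree at least `2 k ≥ k + 1`. -/
theorem mul_sub_mem_polyFamily (hF : NilFiltration p N F) {k : ℕ} (hk : 1 ≤ k)
    {f g d e a b : ℕ → R} (hd : d - 1 ∈ polyFamily F 1) (he : e - 1 ∈ polyFamily F 1)
    (ha : a ∈ polyFamily F k) (hb : b ∈ polyFamily F k)
    (hf : f - d - a ∈ polyFamily F (k + 1)) (hg : g - e - b ∈ polyFamily F (k + 1)) :
    f * g - d * e - (a + b) ∈ polyFamily F (k + 1) := by
  have one := one_mem_polyFamily hF
  have hd0 : d ∈ polyFamily F 0 := by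
    simpa using add_mem (polyFamily_anti (by omega : 0 ≤ 1) hd) one
  have he0 : e ∈ polyFamily F 0 := by
    simpa using add_mem (polyFamily_anti (by omega : 0 ≤ 1) he) one
  have hg0 : g ∈ polyFamily F 0 := by
    have := add_mem (add_mem (polyFamily_anti (Nat.zero_le _) hg)
      (polyFamily_anti (Nat.zero_le _) hb)) he0
    simpa using this
  have h1 := mul_mem_polyFamily hF hf hg0
  have h2 := mul_mem_polyFamily hF hd0 hg
  have h3 := mul_mem_polyFamily hF hd hb
  have h4 := mul_mem_polyFamily hF ha he
  have h5 := mul_mem_polyFamily hF ha (polyFamily_anti hk hb)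
  have h6 := mul_mem_polyFamily hF ha (polyFamily_anti (by omega : 1 ≤ k + 1) hg)
  rw [add_zero] at h1
  rw [zero_add] at h2
  rw [add_comm 1] at h3
  have : f * g - d * e - (a + b) = (f - d - a) * g + d * (g - e - b) + (d - 1) * b + a * (e - 1)
      + a * b + a * (g - e - b) := by noncomm_ring
  rw [this]
  exact add_mem (add_mem (add_mem (add_mem (add_mem h1 h2) h3) h4) h5) h6

theorem pow_sub_mem_polyFamily (hp : p.Prime) (hF : NilFiltration p N F)
    (hc : InvFactorial p N c) {k : ℕ} (hk : 1 ≤ k) {z : R} (hz : z ∈ F 1) {f a : ℕ → R}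
    (ha : a ∈ polyFamily F k) (hf : f - expFamily p c z - a ∈ polyFamily F (k + 1)) (r : ℕ) :
    f ^ r - expFamily p c (r • z) - r • a ∈ polyFamily F (k + 1) := by
  induction r with
  | zero =>
    have : expFamily p c (0 • z) = 1 := by
      funext s; simp [expFamily, truncExp_zero hp hc]
    rw [this]
    simp
  | succ r ih =>
    have := mul_sub_mem_polyFamily hF hk
      (expFamily_sub_one_mem hp hF hc (AddSubgroup.nsmul_mem _ hz r))
      (expFamily_sub_one_mem hp hF hc hz) (AddSubgroup.nsmul_mem _ ha r) ha ih hf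
    have e := expFamily_add_smul hp hF hc hz r 1
    rw [one_smul] at e
    rwa [e, ← pow_succ, ← succ_nsmul] at this

/-- For `2 ≤ k < p` there are `r₁ + r₂ t ≡ 1` and `r₁ + r₂ t ^ k ≡ 0` modulo `p ^ N`. -/
theorem exists_weights (hp : p.Prime) (N : ℕ) {k : ℕ} (hk : 2 ≤ k) (hkp : k < p) :
    ∃ t r₁ r₂ : ℕ, ((p : ℤ) ^ N) ∣ ((r₁ + r₂ * t : ℕ) : ℤ) - 1 ∧
      ((p : ℤ) ^ N) ∣ ((r₁ + r₂ * t ^ k : ℕ) : ℤ) := by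
  have := Fact.mk hp
  obtain ⟨g, hg⟩ := IsCyclic.exists_generator (α := (ZMod p)ˣ)
  have hord : orderOf g = p - 1 := by
    rw [orderOf_eq_card_of_forall_mem_zpowers hg, Nat.card_eq_fintype_card, ZMod.card_units]
  -- With `t` a primitive root modulo `p` and `1 ≤ k - 1 < p - 1`, the integer `t - t ^ k` is prime
  -- to `p`.
  set t := (g : ZMod p).val with ht
  have htg : (t : ZMod p) = g := by simp [ht]
  have hne : ((t : ℤ) - (t : ℤ) ^ k : ℤ) ≠ (0 : ZMod p) := by
    push_cast
    rw [htg, sub_ne_zero]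
    intro h
    have h' : g ^ (k - 1) = 1 := by
      have : g * g ^ (k - 1) = g * 1 := by
        rw [mul_one, ← pow_succ']
        ext
        rw [show k - 1 + 1 = k by omega]
        push_cast
        exact h.symm
      exact mul_left_cancel this
    have := Nat.le_of_dvd (by omega) (orderOf_dvd_of_pow_eq_one h')
    omega
  have hcop : IsCoprime ((p : ℤ) ^ N) ((t : ℤ) - (t : ℤ) ^ k) := by
    refine IsCoprime.pow_left ?_
    rw [(Nat.prime_iff_prime_int.mp hp).coprime_iff_not_dvd]
    intro h
    exact hne ((ZMod.intCast_zmod_eq_zero_iff_dvd _ p).mpr h)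
  obtain ⟨a, b, hab⟩ := hcop
  have hpos : (0 : ℤ) < (p : ℤ) ^ N := by have := hp.pos; positivity
  have nat : ∀ x : ℤ, ∃ r : ℕ, ((p : ℤ) ^ N) ∣ (r : ℤ) - x := by
    intro x
    refine ⟨(x % (p : ℤ) ^ N).toNat, ?_⟩
    rw [Int.toNat_of_nonneg (Int.emod_nonneg _ hpos.ne')]
    exact ⟨-(x / (p : ℤ) ^ N), by have := Int.emod_add_mul_ediv x ((p : ℤ) ^ N); linarith⟩
  -- Here `b` inverts `t - t ^ k`, so `r₂ ≡ b` and `r₁ ≡ -t ^ k b` solve both congruences. Natural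
  -- representatives are needed because they serve as exponents.
  obtain ⟨r₂, u₂, h₂⟩ := nat b
  obtain ⟨r₁, u₁, h₁⟩ := nat (-(t : ℤ) ^ k * b)
  refine ⟨t, r₁, r₂, ⟨u₁ + u₂ * t - a, ?_⟩, ⟨u₁ + u₂ * t ^ k, ?_⟩⟩
  · push_cast
    linear_combination h₁ + (t : ℤ) * h₂ + hab
  · push_cast
    linear_combination h₁ + (t : ℤ) ^ k * h₂

/-- The exponentials lying in a group are closed under adding the exponents. -/
theorem truncExp_add_mem (hp : p.Prime) (hF : NilFiltration p N F)
    (hc : InvFactorial p N c) (G : Submonoid R) {x y : R} (hx : x ∈ F 1) (hy : y ∈ F 1)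
    (hxG : ∀ s : ℕ, truncExp p c (s • x) ∈ G) (hyG : ∀ s : ℕ, truncExp p c (s • y) ∈ G) (s : ℕ) :
    truncExp p c (s • (x + y)) ∈ G := by
  have hz : x + y ∈ F 1 := add_mem hx hy
  set z := x + y with hzdef
  -- Group-valued families approximate `exp (s z)` to increasing degree, starting with `exp (s x)
  -- exp (s y)`. At degree `p` the error is zero.
  have key : ∀ k, k + 2 ≤ p → ∃ f : ℕ → R, (∀ s, f s ∈ G) ∧
      f - expFamily p c z ∈ polyFamily F (k + 2) := by
    intro k
    induction k with
    | zero =>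
      intro _
      refine ⟨expFamily p c x * expFamily p c y, fun s => mul_mem (hxG s) (hyG s), ?_⟩
      have h := mul_sub_mem_polyFamily hF (k := 1) le_rfl (d := 1) (e := 1)
        (by simp) (by simp) (linear_mem_polyFamily hx) (linear_mem_polyFamily hy)
        (expFamily_sub_mem hp hF hc hx) (expFamily_sub_mem hp hF hc hy)
      have h' := sub_mem h (expFamily_sub_mem hp hF hc hz)
      convert h' using 1
      funext s
      simp only [Pi.sub_apply, Pi.add_apply, Pi.mul_apply, Pi.one_apply, hzdef, smul_add]
      noncomm_ring
    | succ k ih =>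
      intro hk
      obtain ⟨f, hfG, hf⟩ := ih (by omega)
      obtain ⟨t, r₁, r₂, h₁, h₂⟩ := exists_weights hp N (k := k + 2) (by omega) (by omega)
      set d := f - expFamily p c z with hd
      have hscale : (fun s => f (t * s)) - expFamily p c (t • z) - (t ^ (k + 2)) • d
          ∈ polyFamily F (k + 2 + 1) := by
        convert polyFamily_scale hf t using 1
        funext s
        simp only [Pi.sub_apply, Pi.smul_apply, hd, expFamily, smul_smul, mul_comm s t]
      have e₁ := pow_sub_mem_polyFamily hp hF hc (by omega) hz hf
        (show f - expFamily p c z - d ∈ polyFamily F (k + 2 + 1) by simp [hd]) r₁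
      have htz := AddSubgroup.nsmul_mem _ hz t
      have e₂ := pow_sub_mem_polyFamily hp hF hc (by omega) htz
        (AddSubgroup.nsmul_mem _ hf _) hscale r₂
      have e := mul_sub_mem_polyFamily hF (by omega)
        (expFamily_sub_one_mem hp hF hc (AddSubgroup.nsmul_mem _ hz r₁))
        (expFamily_sub_one_mem hp hF hc (AddSubgroup.nsmul_mem _ htz r₂))
        (AddSubgroup.nsmul_mem _ hf r₁)
        (AddSubgroup.nsmul_mem _ (AddSubgroup.nsmul_mem _ hf _) r₂) e₁ e₂
      -- The exponent becomes `(r₁ + r₂ t) z = z` and the leading error `(r₁ + r₂ t ^ (k + 2)) d =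
      -- 0`.
      refine ⟨f ^ r₁ * (fun s => f (t * s)) ^ r₂,
        fun s => mul_mem (pow_mem (hfG s) _) (pow_mem (hfG _) _), ?_⟩
      have hz1 : (r₁ + r₂ * t) • z = z := by
        have := hF.zsmul_congr hz h₁
        rwa [one_smul, natCast_zsmul] at this
      have hd0 : r₁ • d + r₂ • t ^ (k + 2) • d = 0 := by
        rw [smul_smul, ← add_smul]
        funext s
        have := hF.zsmul_congr (hF.anti (by omega) (polyFamily_apply_mem hF hf s))
          (a := ((r₁ + r₂ * t ^ (k + 2) : ℕ) : ℤ)) (b := 0) (by simpa using h₂)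
        rwa [zero_smul, natCast_zsmul] at this
      rw [smul_smul, expFamily_add_smul hp hF hc hz, hz1, hd0, sub_zero] at e
      exact e
  have h2 := hp.two_le
  obtain ⟨f, hfG, hf⟩ := key (p - 2) (by omega)
  have := hF.eq_zero (by omega) (polyFamily_apply_mem hF hf s)
  have h3 : f s = expFamily p c z s := sub_eq_zero.mp this
  have h4 := hfG s
  rwa [h3] at h4

end

theorem end_mul_apply {V : Type*} [AddCommGroup V] (f g : AddMonoid.End V) (v : V) :
    (f * g) v = f (g v) := rfl

theorem end_ext {V : Type*} [AddCommGroup V] {f g : AddMonoid.End V} (h : ∀ v, f v = g v) :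
    f = g := AddMonoidHom.ext h

/-! ### The lambda maps and the ascending fixed-point series -/

namespace LeftBrace

variable {A : Type*} [AddCommGroup A] (B : LeftBrace A)

theorem mul_zero' (a : A) : B.group.mul a 0 = a := by
  have h := B.distrib a 0 0
  rw [add_zero] at h
  exact (add_left_cancel h).symm

theorem one_eq_zero : B.group.one = 0 := by
  have h1 : B.group.mul B.group.one 0 = 0 := B.group.one_mul 0
  rw [B.mul_zero'] at h1
  exact h1

/-- The additive map `λ_a : v ↦ a ∘ v - a`. -/
def lam (a : A) : AddMonoid.End A :=
  AddMonoidHom.mk' (fun v => B.group.mul a v - a) fun x y => by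
    have h := B.distrib a x y
    rw [eq_sub_of_add_eq h]
    abel

theorem lam_apply (a v : A) : B.lam a v = B.group.mul a v - a := rfl

theorem star_eq (a v : A) : B.star a v = B.lam a v - v := rfl

theorem mul_eq (a v : A) : B.group.mul a v = a + B.lam a v := by
  rw [lam_apply]; abel

theorem lam_mul (a b : A) : B.lam (B.group.mul a b) = B.lam a * B.lam b := by
  ext v
  have h := B.distrib a (B.group.mul b v - b) b
  rw [sub_add_cancel] at h
  have e : B.group.mul (B.group.mul a b) v = B.group.mul a (B.group.mul b v) :=
    B.group.mul_assoc a b v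
  rw [end_mul_apply, lam_apply, lam_apply, lam_apply, e, eq_sub_of_add_eq h]
  abel

theorem lam_zero : B.lam 0 = 1 := by
  ext v
  have : B.group.mul 0 v = v := by
    rw [← B.one_eq_zero]
    exact B.group.one_mul v
  simp [lam_apply, this]

/-- The ascending series `U₀ = 0`, `U_{i + 1} = {v | a * v ∈ U_i for all a}`. -/
def fixSeries : ℕ → AddSubgroup A
  | 0 => ⊥
  | i + 1 =>
    { carrier := {v | ∀ a, B.star a v ∈ fixSeries i}
      zero_mem' := fun a => by simp [star_eq]
      add_mem' := fun {x y} hx hy a => by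
        have := add_mem (hx a) (hy a)
        rw [star_eq, star_eq] at this
        rw [star_eq, map_add]
        convert this using 1
        abel
      neg_mem' := fun {x} hx a => by
        have := neg_mem (hx a)
        rw [star_eq] at this
        rw [star_eq, map_neg]
        convert this using 1
        abel }

theorem fixSeries_le_succ (i : ℕ) : B.fixSeries i ≤ B.fixSeries (i + 1) := by
  induction i with
  | zero => exact bot_le
  | succ i ih => exact fun v hv a => ih (hv a)

theorem fixSeries_mono : Monotone B.fixSeries := monotone_nat_of_le_succ B.fixSeries_le_succ

theorem lam_mem_fixSeries {i : ℕ} {v : A} (hv : v ∈ B.fixSeries i) (a : A) :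
    B.lam a v ∈ B.fixSeries i := by
  have h : B.star a v ∈ B.fixSeries i := B.fixSeries_le_succ i hv a
  rw [star_eq] at h
  simpa using add_mem h hv

/-- The `p`-group `(A,∘)` acts through `λ` on the non-trivial `p`-group `A / U_i`, so besides `0` it
fixes another coset; a representative lies in `U_{i+1}` but not in `U_i`. -/
theorem fixSeries_lt_succ {p n : ℕ} (hp : p.Prime) (hA : Nat.card A = p ^ n) {i : ℕ}
    (hi : B.fixSeries i ≠ ⊤) : B.fixSeries i < B.fixSeries (i + 1) := by
  have := Fact.mk hp
  have : Finite A := Nat.finite_of_card_ne_zero (by rw [hA]; exact pow_ne_zero _ hp.ne_zero)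
  set U := B.fixSeries i with hU
  let Λ : A → (A ⧸ U) →+ (A ⧸ U) := fun a =>
    QuotientAddGroup.map U U (B.lam a) (fun v hv => B.lam_mem_fixSeries hv a)
  let _ := B.group
  let _ : MulAction A (A ⧸ U) :=
    { smul := fun a q => Λ a q
      one_smul := by
        intro q
        induction q using QuotientAddGroup.induction_on with
        | H v =>
          change ((B.lam B.group.one v : A) : A ⧸ U) = v
          rw [B.one_eq_zero, lam_zero]
          rfl
      mul_smul := by
        intro a b q
        induction q using QuotientAddGroup.induction_on with
        | H v =>
          change ((B.lam (B.group.mul a b) v : A) : A ⧸ U) = ((B.lam a (B.lam b v) : A) : A ⧸ U)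
          rw [lam_mul]
          rfl }
  have hG : IsPGroup p A := IsPGroup.of_card hA
  have hdvd : p ∣ Nat.card (A ⧸ U) := by
    have h1 : Nat.card (A ⧸ U) ∣ p ^ n := by
      rw [← hA, AddSubgroup.card_eq_card_quotient_mul_card_addSubgroup U]
      exact dvd_mul_right _ _
    obtain ⟨k, -, hk⟩ := (Nat.dvd_prime_pow hp).mp h1
    rcases Nat.eq_zero_or_pos k with rfl | hk0
    · exact absurd (AddSubgroup.index_eq_one.mp (by simpa [AddSubgroup.index] using hk)) hi
    · rw [hk]; exact dvd_pow_self p hk0.ne'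
  have h0 : (0 : A ⧸ U) ∈ MulAction.fixedPoints A (A ⧸ U) := fun a => map_zero (Λ a)
  obtain ⟨q, hq, hne⟩ :=
    hG.exists_fixed_point_of_prime_dvd_card_of_fixed_point (A ⧸ U) hdvd h0
  induction q using QuotientAddGroup.induction_on with
  | H v =>
    refine lt_of_le_of_ne (B.fixSeries_le_succ i) fun heq => ?_
    have hv : v ∈ B.fixSeries (i + 1) := by
      intro a
      have h := hq a
      change ((B.lam a v : A) : A ⧸ U) = v at h
      rw [star_eq]
      exact (QuotientAddGroup.eq_iff_sub_mem.mp h)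
    rw [← heq] at hv
    exact hne ((QuotientAddGroup.eq_zero_iff v).mpr hv).symm

theorem fixSeries_eq_top {p n : ℕ} (hp : p.Prime) (hA : Nat.card A = p ^ n) :
    B.fixSeries n = ⊤ := by
  have : Finite A := Nat.finite_of_card_ne_zero (by rw [hA]; exact pow_ne_zero _ hp.ne_zero)
  have hcard : ∀ U : AddSubgroup A, ∃ k, Nat.card U = p ^ k := fun U => by
    obtain ⟨k, -, hk⟩ := (Nat.dvd_prime_pow hp).mp (hA ▸ AddSubgroup.card_addSubgroup_dvd_card U)
    exact ⟨k, hk⟩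
  have key : ∀ i, B.fixSeries i = ⊤ ∨ p ^ i ∣ Nat.card (B.fixSeries i) := by
    intro i
    induction i with
    | zero => simp
    | succ i ih =>
      by_cases hi : B.fixSeries i = ⊤
      · exact Or.inl (top_le_iff.mp (hi ▸ B.fixSeries_le_succ i))
      · right
        have hlt := B.fixSeries_lt_succ hp hA hi
        replace ih := ih.resolve_left hi
        obtain ⟨a, ha⟩ := hcard (B.fixSeries i)
        obtain ⟨b, hb⟩ := hcard (B.fixSeries (i + 1))
        rw [ha] at ih
        rw [hb]
        have hia := (Nat.pow_dvd_pow_iff_le_right hp.one_lt).mp ih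
        refine pow_dvd_pow p ?_
        by_contra hcon
        refine hlt.ne (AddSubgroup.eq_of_le_of_card_ge hlt.le ?_)
        rw [ha, hb]
        exact Nat.pow_le_pow_right hp.pos (by omega)
  rcases key n with h | h
  · exact h
  · refine AddSubgroup.eq_top_of_card_eq _ (Nat.dvd_antisymm ?_ ?_)
    · exact AddSubgroup.card_addSubgroup_dvd_card _
    · rwa [hA]

end LeftBrace

/-! ### Filtrations of `A × ℤ` and of its endomorphism ring -/

section

variable {A : Type*} [AddCommGroup A]

/-- The filtration `A × ℤ ⊇ U_n × 0 ⊇ U_{n - 1} × 0 ⊇ ⋯` for an ascending series `U` of `A`. -/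
def affineSeries (U : ℕ → AddSubgroup A) (n : ℕ) : ℕ → AddSubgroup (A × ℤ)
  | 0 => ⊤
  | j + 1 => (U (n - j)).prod ⊥

theorem mem_affineSeries_succ {U : ℕ → AddSubgroup A} {n j : ℕ} {v : A × ℤ} :
    v ∈ affineSeries U n (j + 1) ↔ v.1 ∈ U (n - j) ∧ v.2 = 0 := by
  simp [affineSeries, AddSubgroup.mem_prod]

theorem affineSeries_anti {U : ℕ → AddSubgroup A} (hU : Monotone U) (n : ℕ) :
    Antitone (affineSeries U n) := by
  refine antitone_nat_of_succ_le fun j => ?_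
  cases j with
  | zero => exact le_top
  | succ j =>
    intro v hv
    rw [mem_affineSeries_succ] at hv ⊢
    exact ⟨hU (by omega) hv.1, hv.2⟩

/-- The induced filtration of the endomorphism ring. -/
def endFiltration {V : Type*} [AddCommGroup V] (E : ℕ → AddSubgroup V) (i : ℕ) :
    AddSubgroup (AddMonoid.End V) where
  carrier := {φ | ∀ j, ∀ v ∈ E j, φ v ∈ E (i + j)}
  zero_mem' := fun _ _ _ => zero_mem _
  add_mem' := fun hx hy j v hv => add_mem (hx j v hv) (hy j v hv)
  neg_mem' := fun hx j v hv => neg_mem (hx j v hv)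

/-- An endomorphism of degree `p` maps everything into `U_0 × 0 = 0`, because `n < p`. One of degree
`1` has values in `A × 0`, hence is torsion; the identity of `A × ℤ` is not. -/
theorem endFiltration_nil {U : ℕ → AddSubgroup A} (hU : Monotone U) (hU0 : U 0 = ⊥) {p n N : ℕ}
    (hn : n < p) (hA : ∀ a : A, ((p : ℤ) ^ N) • a = 0) :
    NilFiltration p N (endFiltration (affineSeries U n)) where
  anti := fun i k h φ hφ j v hv => affineSeries_anti hU n (by omega) (hφ j v hv)
  one_mem := fun j v hv => by simpa using hv
  mul_mem := fun {i k φ ψ} hφ hψ j v hv => by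
    have := hφ _ _ (hψ j v hv)
    rwa [← add_assoc] at this
  bot := by
    rw [eq_bot_iff]
    intro φ hφ
    rw [AddSubgroup.mem_bot]
    refine end_ext fun v => ?_
    have h := hφ 0 v trivial
    obtain ⟨q, rfl⟩ : ∃ q, p = q + 1 := ⟨p - 1, by omega⟩
    rw [add_zero, mem_affineSeries_succ, show n - q = 0 by omega, hU0] at h
    exact Prod.ext h.1 h.2
  tors := fun {φ} hφ => by
    refine end_ext fun v => ?_
    have h := hφ 0 v trivial
    rw [add_zero, show 1 = 0 + 1 from rfl, mem_affineSeries_succ] at h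
    refine Prod.ext (hA _) ?_
    change ((p : ℤ) ^ N) • (φ v).2 = 0
    rw [h.2, smul_zero]

end

/-! ### The affine group of a brace and its logarithms -/

namespace LeftBrace

variable {A : Type*} [AddCommGroup A] (B : LeftBrace A)

/-- The affine map `v ↦ λ_b v + b`, acting linearly on `A × ℤ`. -/
def affine (b : A) : AddMonoid.End (A × ℤ) :=
  AddMonoidHom.mk' (fun w => (B.lam b w.1 + w.2 • b, w.2)) fun x y => by
    refine Prod.ext ?_ rfl
    simp only [Prod.fst_add, Prod.snd_add, map_add, add_smul]
    abel

theorem affine_apply (b : A) (w : A × ℤ) : B.affine b w = (B.lam b w.1 + w.2 • b, w.2) := rfl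

theorem affine_mul (a b : A) : B.affine (B.group.mul a b) = B.affine a * B.affine b := by
  refine end_ext fun w => ?_
  rw [end_mul_apply, affine_apply, affine_apply, affine_apply, lam_mul, mul_eq]
  refine Prod.ext ?_ rfl
  simp only [end_mul_apply, map_add, map_zsmul, smul_add]
  abel

theorem affine_zero : B.affine 0 = 1 := by
  refine end_ext fun w => ?_
  rw [affine_apply, lam_zero]
  change (w.1 + w.2 • (0 : A), w.2) = w
  rw [smul_zero, add_zero]

/-- The group of all affine maps of a brace. -/
def affineGroup : Submonoid (AddMonoid.End (A × ℤ)) where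
  carrier := Set.range B.affine
  one_mem' := ⟨0, B.affine_zero⟩
  mul_mem' := by
    rintro _ _ ⟨a, rfl⟩ ⟨b, rfl⟩
    exact ⟨_, B.affine_mul a b⟩

theorem affine_sub_one_mem {n : ℕ} (hn : B.fixSeries n = ⊤) (b : A) :
    B.affine b - 1 ∈ endFiltration (affineSeries B.fixSeries n) 1 := by
  intro j v hv
  have e : (B.affine b - 1) v = (B.lam b v.1 + v.2 • b - v.1, 0) := by
    change B.affine b v - v = _
    rw [affine_apply]
    exact Prod.ext rfl (sub_self _)
  rw [add_comm 1 j, e, mem_affineSeries_succ]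
  refine ⟨?_, rfl⟩
  cases j with
  | zero => rw [Nat.sub_zero, hn]; trivial
  | succ j =>
    rw [mem_affineSeries_succ] at hv
    simp only [hv.2, zero_smul, add_zero]
    rw [← star_eq]
    rcases Nat.eq_zero_or_pos (n - j) with h0 | h0
    · have h1 := hv.1
      rw [h0] at h1
      have h2 : v.1 = 0 := h1
      rw [h2, star_eq, map_zero, sub_zero]
      exact zero_mem _
    · have h1 := hv.1
      rw [show n - j = n - (j + 1) + 1 by omega] at h1
      exact h1 b

/-- The additive structure on the logarithms of the affine maps of a brace. -/
def logs {p N n : ℕ} {c : ℕ → ℤ} (hp : p.Prime)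
    (hF : NilFiltration p N (endFiltration (affineSeries B.fixSeries n)))
    (hc : InvFactorial p N c) : AddSubgroup (AddMonoid.End (A × ℤ)) where
  carrier := {x | x ∈ endFiltration (affineSeries B.fixSeries n) 1 ∧
    ∀ s : ℕ, truncExp p c (s • x) ∈ B.affineGroup}
  zero_mem' := ⟨zero_mem _, fun s => by
    rw [nsmul_zero, truncExp_zero hp hc]; exact one_mem _⟩
  add_mem' := fun hx hy => ⟨add_mem hx.1 hy.1, fun s =>
    truncExp_add_mem hp hF hc B.affineGroup hx.1 hy.1 hx.2 hy.2 s⟩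
  neg_mem' := fun {x} hx => ⟨neg_mem hx.1, fun s => by
    have : -x = (p ^ N - 1) • x := by
      have h1 := hF.tors hx.1
      have h2 : (p ^ N - 1 + 1) • x = 0 := by
        rw [Nat.sub_add_cancel (Nat.one_le_pow _ _ hp.pos)]
        exact_mod_cast h1
      rw [add_smul, one_smul] at h2
      exact (eq_neg_of_add_eq_zero_left h2).symm
    rw [this, smul_smul]
    exact hx.2 _⟩

/-- A brace of order `p ^ n`, `n < p`, is the group of flows of a pre-Lie structure on its
additive group. -/
theorem exists_flow {p n N : ℕ} {c : ℕ → ℤ} (hp : p.Prime) (hn : n < p)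
    (hcard : Nat.card A = p ^ n) (hA : ∀ a : A, ((p : ℤ) ^ N) • a = 0) (hc : InvFactorial p N c) :
    ∃ M : A →+ AddMonoid.End A, (∀ u, M u ^ p = 0) ∧ ∀ b, ∃ u,
      b = ∑ i ∈ range (p - 1), c (i + 1) • (M u ^ i) u ∧
      ∀ v, B.star b v = ∑ i ∈ range (p - 1), c (i + 1) • (M u ^ (i + 1)) v := by
  have hfin : Finite A :=
    Nat.finite_of_card_ne_zero (by rw [hcard]; exact pow_ne_zero _ hp.ne_zero)
  have hF := endFiltration_nil (p := p) (n := n) B.fixSeries_mono rfl hn hA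
  set F := endFiltration (affineSeries B.fixSeries n) with hFdef
  have hsnd : ∀ x ∈ F 1, ∀ w, (x w).2 = 0 := fun x hx w => (hx 0 w trivial).2
  set L := B.logs hp hF hc
  let f : L →+ A := AddMonoidHom.mk' (fun x => ((x : AddMonoid.End (A × ℤ)) (0, 1)).1)
    fun x y => rfl
  have hsum : ∀ (x : AddMonoid.End (A × ℤ)) (w : A × ℤ),
      truncExp p c x w = w + ∑ i ∈ range (p - 1), c (i + 1) • (x ^ (i + 1)) w := by
    intro x w
    obtain ⟨q, rfl⟩ : ∃ q, p = q + 1 := ⟨p - 1, by have := hp.pos; omega⟩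
    rw [truncExp, sum_range_succ', hc.zero, pow_zero, one_smul, Nat.add_sub_cancel, add_comm]
    change w + (∑ i ∈ range q, c (i + 1) • x ^ (i + 1)) w = _
    congr 1
    exact AddMonoidHom.finsetSum_apply _ _ _
  -- If `x` kills `(0, 1)`, then `exp x` is an affine map fixing `(0, 1)`, hence has translation
  -- part `0` and equals `1`. Then `exp x - 1 - x = -x` drives `x` down the whole filtration.
  have finj : Function.Injective f := by
    rw [injective_iff_map_eq_zero]
    rintro ⟨x, hx⟩ h0
    have hx0 : x (0, 1) = 0 := Prod.ext h0 (hsnd x hx.1 _)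
    obtain ⟨b, hb⟩ := hx.2 1
    rw [one_smul] at hb
    have h1 : truncExp p c x (0, 1) = (0, 1) := by
      rw [hsum, sum_eq_zero, add_zero]
      intro i _
      rw [pow_succ, end_mul_apply, hx0, map_zero, smul_zero]
    have hb0 : b = 0 := by
      rw [← hb, affine_apply] at h1
      simpa using congrArg Prod.fst h1
    rw [hb0, affine_zero] at hb
    have hk : ∀ k, x ∈ F (k + 1) := by
      intro k
      induction k with
      | zero => exact hx.1
      | succ k ih =>
        have := truncExp_sub_mem hp hF hc (by omega) ih
        rw [← hb, sub_self, zero_sub] at this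
        simpa using neg_mem this
    exact Subtype.ext (hF.eq_zero (by omega) (hk p))
  have hlog : ∀ b, ∃ x : L, truncExp p c (x : AddMonoid.End (A × ℤ)) = B.affine b := by
    intro b
    obtain ⟨x, hx, h⟩ :=
      exists_truncExp_eq hp hF hc (B.affine_sub_one_mem (B.fixSeries_eq_top hp hcard) b)
    refine ⟨⟨x, hx, fun s => ?_⟩, h⟩
    rw [truncExp_nsmul hp hF hc hx, h]
    exact B.affineGroup.pow_mem ⟨b, rfl⟩ s
  choose h hh using hlog
  have hinj : Function.Injective h := by
    intro a b hab
    have h1 := hh a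
    rw [hab, hh b] at h1
    have h2 := congrArg (fun φ : AddMonoid.End (A × ℤ) => (φ (0, 1)).1) h1
    simpa [affine_apply] using h2.symm
  have fsurj : Function.Surjective f := by
    -- The composite is an injective self-map of the finite set `A`, so `L` itself need not be
    -- counted.
    have h1 : Function.Surjective (f ∘ h) := Finite.injective_iff_surjective.mp (finj.comp hinj)
    exact h1.of_comp
  let e : L ≃+ A := AddEquiv.ofBijective f ⟨finj, fsurj⟩
  let M : A →+ AddMonoid.End A :=
    AddMonoidHom.mk' (fun u => (AddMonoidHom.fst A ℤ).comp
      ((e.symm u : AddMonoid.End (A × ℤ)).comp (AddMonoidHom.inl A ℤ))) fun u v => by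
        rw [map_add]; rfl
  have hM : ∀ (x : L) (v : A), (x : AddMonoid.End (A × ℤ)) (v, 0) = (M (f x) v, 0) := by
    intro x v
    have hx : e.symm (f x) = x := e.symm_apply_apply x
    refine Prod.ext ?_ (hsnd _ x.2.1 _)
    change _ = ((e.symm (f x) : AddMonoid.End (A × ℤ)) (v, 0)).1
    rw [hx]
  have hpow : ∀ (x : L) (i : ℕ) (v : A),
      ((x : AddMonoid.End (A × ℤ)) ^ i) (v, 0) = ((M (f x) ^ i) v, 0) := by
    intro x i v
    induction i with
    | zero => rfl
    | succ i ih => rw [pow_succ', end_mul_apply, ih, hM, pow_succ']; rfl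
  refine ⟨M, fun u => ?_, fun b => ⟨f (h b), ?_, fun v => ?_⟩⟩
  · obtain ⟨x, rfl⟩ := fsurj u
    have hx : (x : AddMonoid.End (A × ℤ)) ^ p = 0 :=
      hF.eq_zero (by simp) (hF.pow_mem x.2.1 p)
    refine end_ext fun v => ?_
    have := hpow x p v
    rw [hx] at this
    exact (congrArg Prod.fst this).symm
  · have h1 := hsum (h b) (0, 1)
    rw [hh, affine_apply] at h1
    have h2 := congrArg Prod.fst h1
    simp only [map_zero, one_smul, zero_add, Prod.fst_add, Prod.fst_sum, Prod.smul_fst] at h2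
    rw [h2]
    refine sum_congr rfl fun i _ => ?_
    have h3 : ((h b : AddMonoid.End (A × ℤ))) (0, 1) = (f (h b), 0) :=
      Prod.ext rfl (hsnd _ (h b).2.1 _)
    rw [← h2, pow_succ, end_mul_apply, h3, hpow]
  · have h1 := hsum (h b) (v, 0)
    rw [hh, affine_apply] at h1
    have h2 := congrArg Prod.fst h1
    simp only [zero_smul, add_zero, Prod.fst_add, Prod.fst_sum, Prod.smul_fst] at h2
    rw [star_eq, h2, add_sub_cancel_left]
    exact sum_congr rfl fun i _ => by rw [hpow]

/-- The values of a brace at multiples of `p`. -/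
theorem exists_flow_smul {p n N : ℕ} {c : ℕ → ℤ} (hp : p.Prime) (hn : n < p)
    (hcard : Nat.card A = p ^ n) (hA : ∀ a : A, ((p : ℤ) ^ N) • a = 0) (hc : InvFactorial p N c) :
    ∃ M : A →+ AddMonoid.End A, ∀ a, ∃ v,
      a = ∑ i ∈ range (p - 1), (c (i + 1) * (p : ℤ) ^ i) • (M v ^ i) v ∧
      ∀ y, B.star (p • a) y =
        p • ∑ i ∈ range (p - 1), (c (i + 1) * (p : ℤ) ^ i) • (M v ^ (i + 1)) y := by
  obtain ⟨M, hnil, hM⟩ := B.exists_flow hp hn hcard hA hc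
  refine ⟨M, fun a => ?_⟩
  obtain ⟨u, hu, hstar⟩ := hM (p • a)
  set w : AddMonoid.End A := ∑ i ∈ range (p - 1), c (i + 1) • M u ^ i with hw
  have hwu : ∀ y, w y = ∑ i ∈ range (p - 1), c (i + 1) • (M u ^ i) y := fun y =>
    AddMonoidHom.finsetSum_apply _ _ _
  have hunit : IsUnit w := by
    obtain ⟨q, rfl⟩ : ∃ q, p = q + 2 := ⟨p - 2, by have := hp.two_le; omega⟩
    have hwe : w = 1 + M u * ∑ i ∈ range q, c (i + 1 + 1) • M u ^ i := by
      rw [hw, show q + 2 - 1 = q + 1 by omega, sum_range_succ', mul_sum, zero_add, hc.one,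
        one_smul, pow_zero, add_comm]
      congr 1
      refine sum_congr rfl fun i _ => ?_
      rw [pow_succ', mul_smul_comm]
    rw [hwe]
    -- The operator `w` is `1` plus a multiple of the nilpotent `M u`. Since `p • a = w u`, setting
    -- `v = w⁻¹ a` gives `u = p • v`: the logarithm of a multiple of `p` is again one.
    refine IsNilpotent.isUnit_one_add ?_
    refine Commute.isNilpotent_mul_right ?_ ⟨_, hnil u⟩
    exact Commute.sum_right _ _ _ fun i _ =>
      Commute.smul_right (Commute.pow_right (Commute.refl _) _) _
  obtain ⟨w', hw'⟩ := hunit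
  have hinv : ∀ y, (↑w'⁻¹ : AddMonoid.End A) (w y) = y := fun y => by
    rw [← end_mul_apply, ← hw', Units.inv_mul]; rfl
  have hinv' : ∀ y, w ((↑w'⁻¹ : AddMonoid.End A) y) = y := fun y => by
    rw [← end_mul_apply, ← hw', Units.mul_inv]; rfl
  set v := (↑w'⁻¹ : AddMonoid.End A) a with hv
  have huv : u = p • v := by
    rw [← hinv u, hwu, ← hu, map_nsmul]
  have hMu : M u = (p : ℤ) • M v := by rw [huv, map_nsmul, natCast_zsmul]
  have hterm : ∀ i, c (i + 1) • M u ^ i = (c (i + 1) * (p : ℤ) ^ i) • M v ^ i := fun i => by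
    rw [hMu, smul_pow, smul_smul]
  refine ⟨v, ?_, fun y => ?_⟩
  · rw [← hinv' a, hwu]
    refine sum_congr rfl fun i _ => ?_
    exact DFunLike.congr_fun (hterm i) v
  · rw [hstar, smul_sum]
    refine sum_congr rfl fun i _ => ?_
    have := DFunLike.congr_fun (hterm i) (M u y)
    change c (i + 1) • (M u ^ i) (M u y) = (c (i + 1) * (p : ℤ) ^ i) • (M v ^ i) (M u y) at this
    rw [pow_succ, end_mul_apply, this, hMu, pow_succ, end_mul_apply]
    change _ • (M v ^ i) ((p : ℤ) • M v y) = _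
    rw [map_zsmul, smul_comm, natCast_zsmul]

end LeftBrace

/-! ### Words weighted by powers of `p`, and series inversion -/

/-- The words in `X` alone of degree at least `k`. -/
def wordsX (k : ℕ) : Set (FreeMagma Letter) := {w | k ≤ countX w ∧ countY w = 0}

/-- The words of degree at least `k` in `X` that end with their only `Y`. -/
def wordsXY (k : ℕ) : Set (FreeMagma Letter) :=
  {w | k ≤ countX w ∧ countY w = 1 ∧ lastLetter w = Letter.Y}

section

variable {Q : Type*} [AddCommGroup Q]

/-- The span of the values `p ^ (d - 1) w(a, y)`, where `w ∈ S` has degree `d` in `X`. -/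
def wordSpan (p : ℕ) (M : Q →+ AddMonoid.End Q) (a y : Q) (S : Set (FreeMagma Letter)) :
    AddSubgroup Q :=
  AddSubgroup.closure
    ((fun w => (p ^ (countX w - 1)) • evalWord (fun x z => M x z) a y w) '' S)

variable {p : ℕ} {M : Q →+ AddMonoid.End Q} {a y : Q}

theorem smul_evalWord_mem_wordSpan {S : Set (FreeMagma Letter)} {w : FreeMagma Letter}
    (hw : w ∈ S) :
    (p ^ (countX w - 1)) • evalWord (fun x z => M x z) a y w ∈ wordSpan p M a y S :=
  AddSubgroup.subset_closure ⟨w, hw, rfl⟩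

theorem wordSpan_mono {S T : Set (FreeMagma Letter)} (h : S ⊆ T) :
    wordSpan p M a y S ≤ wordSpan p M a y T :=
  AddSubgroup.closure_mono (Set.image_mono h)

/-- The weight of a word is `p ^ (d - 1)`, so a product of two words of positive degree needs one
further factor `p`. A product with `Y` alone needs none, since truncated subtraction gives `Y`
weight `p ^ 0`; `e` covers both cases. -/
theorem wordSpan_mul_mem {S T U : Set (FreeMagma Letter)} (e : ℕ)
    (h : ∀ u ∈ S, ∀ w ∈ T, FreeMagma.mul u w ∈ U ∧
      e + (countX u - 1) + (countX w - 1) = countX u + countX w - 1)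
    {x z : Q} (hx : x ∈ wordSpan p M a y S) (hz : z ∈ wordSpan p M a y T) :
    (p ^ e) • M x z ∈ wordSpan p M a y U := by
  induction hx using AddSubgroup.closure_induction with
  | zero => rw [map_zero]; change p ^ e • (0 : Q) ∈ _; rw [smul_zero]; exact zero_mem _
  | add x x' _ _ hx hx' =>
    rw [map_add]
    change p ^ e • (M x z + M x' z) ∈ _
    rw [smul_add]
    exact add_mem hx hx'
  | neg x _ hx =>
    rw [map_neg]
    change p ^ e • (-(M x z)) ∈ _
    rw [smul_neg]
    exact neg_mem hx
  | mem x hx =>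
    obtain ⟨u, hu, rfl⟩ := hx
    induction hz using AddSubgroup.closure_induction with
    | zero => rw [map_zero, smul_zero]; exact zero_mem _
    | add z z' _ _ hz hz' => rw [map_add, smul_add]; exact add_mem hz hz'
    | neg z _ hz => rw [map_neg, smul_neg]; exact neg_mem hz
    | mem z hz =>
      obtain ⟨w, hw, rfl⟩ := hz
      obtain ⟨h1, h2⟩ := h u hu w hw
      have h3 := smul_evalWord_mem_wordSpan (p := p) (M := M) (a := a) (y := y) h1
      simp only [countX, evalWord] at h3
      rw [← h2, pow_add, pow_add, mul_smul, mul_smul] at h3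
      simp only [map_nsmul]
      convert h3 using 2
      change p ^ (countX w - 1) • (p ^ (countX u - 1)) • (_ : Q) = _
      rw [smul_comm]
      rfl

theorem smul_mem_wordSpan_X {x z : Q} (hx : x ∈ wordSpan p M a y (wordsX 1))
    (hz : z ∈ wordSpan p M a y (wordsX 1)) : p • M x z ∈ wordSpan p M a y (wordsX 2) := by
  have := wordSpan_mul_mem (U := wordsX 2) 1 (fun u hu w hw => ?_) hx hz
  · rwa [pow_one] at this
  · obtain ⟨h1, h2⟩ := hu
    obtain ⟨h3, h4⟩ := hw
    refine ⟨⟨?_, ?_⟩, ?_⟩ <;> (try simp only [countX, countY]) <;> omega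

theorem smul_mem_wordSpan_XY {x z : Q} (hx : x ∈ wordSpan p M a y (wordsX 1))
    (hz : z ∈ wordSpan p M a y (wordsXY 1)) : p • M x z ∈ wordSpan p M a y (wordsXY 2) := by
  have := wordSpan_mul_mem (U := wordsXY 2) 1 (fun u hu w hw => ?_) hx hz
  · rwa [pow_one] at this
  · obtain ⟨h1, h2⟩ := hu
    obtain ⟨h3, h4, h5⟩ := hw
    refine ⟨⟨?_, ?_, h5⟩, ?_⟩ <;> (try simp only [countX, countY]) <;> omega

theorem apply_mem_wordSpan_XY {k : ℕ} {x : Q} (hk : 1 ≤ k)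
    (hx : x ∈ wordSpan p M a y (wordsX k)) : M x y ∈ wordSpan p M a y (wordsXY k) := by
  have hy : y ∈ wordSpan p M a y {FreeMagma.of Letter.Y} := by
    have := smul_evalWord_mem_wordSpan (p := p) (M := M) (a := a) (y := y)
      (Set.mem_singleton (FreeMagma.of Letter.Y))
    simpa [countX, evalWord] using this
  have := wordSpan_mul_mem (U := wordsXY k) 0 (fun u hu w hw => ?_) hx hy
  · rwa [pow_zero, one_smul] at this
  · obtain ⟨h1, h2⟩ := hu
    obtain rfl := Set.mem_singleton_iff.mp hw
    refine ⟨⟨?_, ?_, rfl⟩, ?_⟩ <;> (try simp only [countX, countY]) <;> omega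

theorem self_mem_wordSpan : a ∈ wordSpan p M a y (wordsX 1) := by
  have := smul_evalWord_mem_wordSpan (p := p) (M := M) (a := a) (y := y)
    (S := wordsX 1) (w := FreeMagma.of Letter.X) ⟨le_rfl, rfl⟩
  simpa [countX, evalWord] using this

/-- Inverting the series `a = v + c₂ p M_v v + c₃ p ^ 2 M_v ^ 2 v + ⋯`. -/
theorem sub_mem_wordSpan {N m : ℕ} {c : ℕ → ℤ} (hc : c 1 = 1)
    (hQ : ∀ x : Q, (p ^ N) • x = 0) {v : Q}
    (ha : a = ∑ i ∈ range (m + 1), (c (i + 1) * (p : ℤ) ^ i) • (M v ^ i) v) :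
    v - a ∈ wordSpan p M a y (wordsX 2) := by
  have hle : wordSpan p M a y (wordsX 2) ≤ wordSpan p M a y (wordsX 1) :=
    wordSpan_mono fun w hw => ⟨by have := hw.1; omega, hw.2⟩
  -- Fixed-point iteration: all terms of the series after `v` carry a factor `p`, so substituting an
  -- approximation of `v` modulo `p ^ j` gives one modulo `p ^ (j + 1)`. At `j = N` the remainder is
  -- zero.
  have key : ∀ j, ∃ r ∈ wordSpan p M a y (wordsX 2), ∃ q, v = a + r + p ^ j • q := by
    intro j
    induction j with
    | zero => exact ⟨0, zero_mem _, v - a, by simp⟩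
    | succ j ih =>
      obtain ⟨r, hr, q, hq⟩ := ih
      have hv' : a + r ∈ wordSpan p M a y (wordsX 1) := add_mem self_mem_wordSpan (hle hr)
      have step : ∀ z ∈ wordSpan p M a y (wordsX 1), ∀ t, ∃ t',
          p • M v (z + p ^ j • t) = p • M (a + r) z + p ^ (j + 1) • t' := by
        intro z _ t
        refine ⟨M q z + M v t, ?_⟩
        have e : M v z = M (a + r) z + p ^ j • M q z := by
          conv_lhs => rw [hq, map_add, map_nsmul]
          rfl
        rw [map_add, map_nsmul, e, pow_succ', mul_smul]
        simp only [smul_add]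
        abel
      have pows : ∀ i, ∃ z ∈ wordSpan p M a y (wordsX 2), ∃ t,
          (p ^ (i + 1)) • (M v ^ (i + 1)) v = z + p ^ (j + 1) • t := by
        intro i
        induction i with
        | zero =>
          obtain ⟨t', ht'⟩ := step _ hv' q
          refine ⟨_, smul_mem_wordSpan_X hv' hv', t', ?_⟩
          rw [← ht', ← hq, zero_add, pow_one, pow_one]
        | succ i ih =>
          obtain ⟨z, hz, t, ht⟩ := ih
          obtain ⟨t', ht'⟩ := step z (hle hz) (p • t)
          refine ⟨_, smul_mem_wordSpan_X hv' (hle hz), t', ?_⟩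
          rw [← ht', smul_smul, ← pow_succ, ← ht, map_nsmul, smul_smul, ← pow_succ', pow_succ' (M v),
            end_mul_apply]
      choose z hz t ht using pows
      refine ⟨-∑ i ∈ range m, c (i + 1 + 1) • z i,
        neg_mem (sum_mem fun i _ => AddSubgroup.zsmul_mem _ (hz i) _),
        -∑ i ∈ range m, c (i + 1 + 1) • t i, ?_⟩
      rw [sum_range_succ'] at ha
      have e : ∑ i ∈ range m, (c (i + 1 + 1) * (p : ℤ) ^ (i + 1)) • (M v ^ (i + 1)) v
          = ∑ i ∈ range m, c (i + 1 + 1) • z i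
            + p ^ (j + 1) • ∑ i ∈ range m, c (i + 1 + 1) • t i := by
        rw [smul_sum, ← sum_add_distrib]
        refine sum_congr rfl fun i _ => ?_
        rw [mul_smul, smul_comm (p ^ (j + 1)), ← smul_add, ← ht]
        congr 1
        rw [← Nat.cast_pow, natCast_zsmul]
      have e0 : (c (0 + 1) * (p : ℤ) ^ 0) • (M v ^ 0) v = v := by
        rw [zero_add, hc, pow_zero, pow_zero, mul_one, one_smul]; rfl
      rw [e, e0] at ha
      rw [smul_neg]
      exact (eq_sub_of_add_eq' ha.symm).trans (by abel)
  obtain ⟨r, hr, q, hq⟩ := key N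
  rw [hQ, add_zero] at hq
  rwa [hq, add_sub_cancel_left]

theorem exists_coeff_of_mem_wordSpan {x : Q} (hx : x ∈ wordSpan p M a y (wordsXY 2)) :
    ∃ α : wordsV →₀ ℤ, (∀ w, (p : ℤ) ^ (countX w.1 - 2) ∣ α w) ∧
      x = p • α.sum fun w k => k • evalWord (fun x z => M x z) a y (w : FreeMagma Letter) := by
  classical
  induction hx using AddSubgroup.closure_induction with
  | zero => exact ⟨0, by simp, by simp⟩
  | add x x' _ _ hx hx' =>
    obtain ⟨α, h1, h2⟩ := hx
    obtain ⟨β, h3, h4⟩ := hx'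
    refine ⟨α + β, fun w => dvd_add (h1 w) (h3 w), ?_⟩
    rw [Finsupp.sum_add_index' (by simp) (by intros; rw [add_smul]), smul_add, ← h2, ← h4]
  | neg x _ hx =>
    obtain ⟨α, h1, h2⟩ := hx
    refine ⟨-α, fun w => (dvd_neg.mpr (h1 w)), ?_⟩
    rw [Finsupp.sum_neg_index (by simp), h2, ← smul_neg]
    simp [Finsupp.sum]
  | mem x hx =>
    obtain ⟨w, hw, rfl⟩ := hx
    refine ⟨Finsupp.single ⟨w, hw⟩ ((p : ℤ) ^ (countX w - 2)), fun w' => ?_, ?_⟩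
    · rw [Finsupp.single_apply]
      split_ifs with h
      · rw [← h]
      · exact dvd_zero _
    · rw [Finsupp.sum_single_index (by simp)]
      have h2 : countX w - 1 = countX w - 2 + 1 := by have := hw.1; omega
      simp only [h2, pow_succ', mul_smul]
      congr 1
      rw [← Nat.cast_pow, natCast_zsmul]

/-- Replacing `v` by `a` in the linear term `M v y` costs only words of degree at least `2`, by
`sub_mem_wordSpan`. Each later term already lies in the span of such words, its `p ^ i` paying for
the extra products. -/
theorem exists_coeff {N m : ℕ} {c : ℕ → ℤ} (hc : c 1 = 1)
    (hQ : ∀ x : Q, (p ^ N) • x = 0) {v : Q}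
    (ha : a = ∑ i ∈ range (m + 1), (c (i + 1) * (p : ℤ) ^ i) • (M v ^ i) v) :
    ∃ α : wordsV →₀ ℤ, (∀ w, (p : ℤ) ^ (countX w.1 - 2) ∣ α w) ∧
      ∑ i ∈ range (m + 1), (c (i + 1) * (p : ℤ) ^ i) • (M v ^ (i + 1)) y =
        M a y + p • α.sum fun w k =>
          k • evalWord (fun x z => M x z) a y (w : FreeMagma Letter) := by
  have hva := sub_mem_wordSpan (y := y) hc hQ ha
  have hle : wordSpan p M a y (wordsX 2) ≤ wordSpan p M a y (wordsX 1) :=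
    wordSpan_mono fun w hw => ⟨by have := hw.1; omega, hw.2⟩
  have hleY : wordSpan p M a y (wordsXY 2) ≤ wordSpan p M a y (wordsXY 1) :=
    wordSpan_mono fun w hw => ⟨by have := hw.1; omega, hw.2⟩
  have hv : v ∈ wordSpan p M a y (wordsX 1) := by
    simpa using add_mem (hle hva) self_mem_wordSpan
  have hvy := apply_mem_wordSpan_XY le_rfl hv
  have pows : ∀ i, (p ^ (i + 1)) • (M v ^ (i + 1 + 1)) y ∈ wordSpan p M a y (wordsXY 2) := by
    intro i
    induction i with
    | zero =>
      have := smul_mem_wordSpan_XY hv hvy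
      rw [zero_add, pow_one, pow_succ, pow_one]
      exact this
    | succ i ih =>
      have := smul_mem_wordSpan_XY hv (hleY ih)
      rw [map_nsmul, smul_smul, ← pow_succ'] at this
      rw [pow_succ' (M v)]
      exact this
  have hmem : ∑ i ∈ range (m + 1), (c (i + 1) * (p : ℤ) ^ i) • (M v ^ (i + 1)) y - M a y
      ∈ wordSpan p M a y (wordsXY 2) := by
    rw [sum_range_succ', add_sub_assoc]
    refine add_mem (sum_mem fun i _ => ?_) ?_
    · rw [mul_smul]
      refine AddSubgroup.zsmul_mem _ ?_ _
      have := pows i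
      rw [← natCast_zsmul] at this
      exact_mod_cast this
    · have := apply_mem_wordSpan_XY (by omega) hva
      rw [map_sub] at this
      rw [zero_add, hc, pow_zero, pow_one, mul_one, one_smul]
      exact this
  obtain ⟨α, h1, h2⟩ := exists_coeff_of_mem_wordSpan hmem
  exact ⟨α, h1, by rw [← h2]; abel⟩

/-- The pointwise product on a family of biadditive operations. -/
def piMul {I : Type*} (M : I → (Q →+ AddMonoid.End Q)) : (I → Q) →+ AddMonoid.End (I → Q) :=
  AddMonoidHom.mk' (fun f => AddMonoidHom.mk' (fun g i => M i (f i) (g i))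
    fun g g' => by funext i; simp) fun f f' => by
      refine end_ext fun g => ?_
      funext i
      change M i (f i + f' i) (g i) = M i (f i) (g i) + M i (f' i) (g i)
      rw [map_add]
      rfl

theorem piMul_apply {I : Type*} (M : I → (Q →+ AddMonoid.End Q)) (f g : I → Q) (i : I) :
    piMul M f g i = M i (f i) (g i) := rfl

theorem piMul_pow_apply {I : Type*} (M : I → (Q →+ AddMonoid.End Q)) (f g : I → Q) (k : ℕ)
    (i : I) : (piMul M f ^ k) g i = (M i (f i) ^ k) (g i) := by
  induction k with
  | zero => rfl
  | succ k ih => rw [pow_succ', end_mul_apply, piMul_apply, ih, pow_succ', end_mul_apply]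

theorem evalWord_piMul {I : Type*} (M : I → (Q →+ AddMonoid.End Q)) (f g : I → Q) (i : I)
    (w : FreeMagma Letter) :
    evalWord (fun x z => piMul M x z) f g w i
      = evalWord (fun x z => M i x z) (f i) (g i) w := by
  induction w with
  | ih1 l => cases l <;> rfl
  | ih2 u v hu hv =>
    change piMul M _ _ i = M i (evalWord _ _ _ u) (evalWord _ _ _ v)
    rw [← hu, ← hv]
    rfl

/-- The coefficients can be chosen uniformly for all biadditive operations on `Q`. -/
theorem exists_uniform_coeff (Q : Type*) [AddCommGroup Q] {N m : ℕ} {c : ℕ → ℤ} (hc : c 1 = 1)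
    (hQ : ∀ x : Q, (p ^ N) • x = 0) :
    ∃ α : wordsV →₀ ℤ, (∀ w, (p : ℤ) ^ (countX w.1 - 2) ∣ α w) ∧
      ∀ (M : Q →+ AddMonoid.End Q) (a v y : Q),
        a = ∑ i ∈ range (m + 1), (c (i + 1) * (p : ℤ) ^ i) • (M v ^ i) v →
        ∑ i ∈ range (m + 1), (c (i + 1) * (p : ℤ) ^ i) • (M v ^ (i + 1)) y =
          M a y + p • α.sum fun w k =>
            k • evalWord (fun x z => M x z) a y (w : FreeMagma Letter) := by
  -- One universal instance: in `I → Q`, with the tautological operation and arguments, a single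
  -- choice of coefficients specialises at each index to every operation on `Q`.
  let I := (Q →+ AddMonoid.End Q) × Q × Q
  let M : (I → Q) →+ AddMonoid.End (I → Q) := piMul fun i => i.1
  obtain ⟨α, h1, h2⟩ := exists_coeff (Q := I → Q) (M := M) (p := p) (N := N) (m := m)
    (y := fun i => i.2.2) (v := fun i => i.2.1) hc (fun x => funext fun i => hQ (x i)) rfl
  refine ⟨α, h1, fun M₀ a v y ha => ?_⟩
  have h3 := congrFun h2 (M₀, v, y)
  have happ : (∑ i ∈ range (m + 1), (c (i + 1) * (p : ℤ) ^ i) •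
      (M (fun i => i.2.1) ^ i) (fun i => i.2.1)) (M₀, v, y) = a := by
    rw [ha, Finset.sum_apply]
    exact sum_congr rfl fun i _ => by rw [Pi.smul_apply, piMul_pow_apply]
  rw [Finset.sum_apply, Pi.add_apply, Pi.smul_apply, piMul_apply, happ, Finsupp.sum,
    Finset.sum_apply] at h3
  rw [Finsupp.sum]
  simp only [Pi.smul_apply, M, piMul_pow_apply, evalWord_piMul] at h3
  simp only [M] at happ
  rw [happ] at h3
  exact h3

end

/-! ### Averaging over the powers of `ξ` -/

section

variable {p : ℕ} {γ : ℤ}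

theorem dvd_teichmuller_pow_sub_one (hp : p.Prime)
    (hγ : IsPrimitiveRoot (γ : ZMod (p ^ p)) (Nat.totient (p ^ p))) :
    (p : ℤ) ^ p ∣ (γ ^ (p ^ (p - 1))) ^ (p - 1) - 1 := by
  have h := hγ.pow_eq_one
  rw [Nat.totient_prime_pow hp hp.pos, pow_mul] at h
  have h' : (((γ ^ (p ^ (p - 1))) ^ (p - 1) - 1 : ℤ) : ZMod (p ^ p)) = 0 := by
    push_cast
    rw [h, sub_self]
  have := (ZMod.intCast_zmod_eq_zero_iff_dvd _ (p ^ p)).mp h'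
  exact_mod_cast this

/-- Modulo `p`, `ξ` equals `γ`. If `γ ^ e ≡ 1` modulo `p`, raising to the power `p ^ (p - 1)` lifts
this to a congruence modulo `p ^ p`, contradicting the order `p ^ (p - 1) (p - 1)` of `γ`. -/
theorem not_dvd_teichmuller_pow_sub_one (hp : p.Prime)
    (hγ : IsPrimitiveRoot (γ : ZMod (p ^ p)) (Nat.totient (p ^ p))) {e : ℕ} (he : 1 ≤ e)
    (hep : e < p - 1) : ¬ (p : ℤ) ∣ (γ ^ (p ^ (p - 1))) ^ e - 1 := by
  intro h
  have := Fact.mk hp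
  have h1 : (p : ℤ) ∣ γ ^ e - 1 := by
    rw [← ZMod.intCast_zmod_eq_zero_iff_dvd] at h ⊢
    push_cast at h ⊢
    rwa [ZMod.pow_card_pow] at h
  have h2 := dvd_sub_pow_of_dvd_sub h1 (p - 1)
  rw [Nat.sub_add_cancel hp.one_le, one_pow, ← pow_mul] at h2
  have h3 : (γ : ZMod (p ^ p)) ^ (e * p ^ (p - 1)) = 1 := by
    have : ((γ ^ (e * p ^ (p - 1)) - 1 : ℤ) : ZMod (p ^ p)) = 0 := by
      rw [ZMod.intCast_zmod_eq_zero_iff_dvd]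
      exact_mod_cast h2
    push_cast at this
    exact sub_eq_zero.mp this
  have h4 := hγ.dvd_of_pow_eq_one _ h3
  rw [Nat.totient_prime_pow hp hp.pos, mul_comm e] at h4
  have h5 := Nat.le_of_dvd he (Nat.dvd_of_mul_dvd_mul_left (pow_pos hp.pos _) h4)
  omega

/-- The weight `∑ ξ ^ (p - 1 - i) ξ ^ (i d)` with which a word of degree `d` enters `•`. -/
def averageWeight (p : ℕ) (γ : ℤ) (d : ℕ) : ℤ :=
  ∑ i ∈ range (p - 1), (γ ^ (p ^ (p - 1))) ^ (p - 1 - i) * ((γ ^ (p ^ (p - 1))) ^ i) ^ d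

theorem averageWeight_succ (d : ℕ) : averageWeight p γ (d + 1) =
    (γ ^ (p ^ (p - 1))) ^ (p - 1) *
      ∑ i ∈ range (p - 1), ((γ ^ (p ^ (p - 1))) ^ d) ^ i := by
  rw [averageWeight, mul_sum]
  refine sum_congr rfl fun i hi => ?_
  have hi' : p - 1 = p - 1 - i + i := by simp at hi; omega
  generalize γ ^ (p ^ (p - 1)) = ξ
  calc ξ ^ (p - 1 - i) * (ξ ^ i) ^ (d + 1) = ξ ^ (p - 1 - i + i) * (ξ ^ d) ^ i := by ring
    _ = _ := by rw [← hi']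

theorem averageWeight_one (hp : p.Prime)
    (hγ : IsPrimitiveRoot (γ : ZMod (p ^ p)) (Nat.totient (p ^ p))) :
    (p : ℤ) ^ p ∣ averageWeight p γ 1 - (p - 1) := by
  rw [averageWeight_succ 0]
  have e : ∑ i ∈ range (p - 1), ((γ ^ (p ^ (p - 1))) ^ 0) ^ i = (p : ℤ) - 1 := by
    simp [Nat.cast_sub hp.one_le]
  rw [e]
  obtain ⟨t, ht⟩ := dvd_teichmuller_pow_sub_one hp hγ
  exact ⟨t * (p - 1), by linear_combination ((p : ℤ) - 1) * ht⟩

/-- A geometric sum of ratio `ξ ^ (d - 1)`: multiplied by `ξ ^ (d - 1) - 1`, which is prime to `p`,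
it becomes `ξ ^ ((d - 1) (p - 1)) - 1`, which `p ^ p` divides. -/
theorem dvd_averageWeight (hp : p.Prime)
    (hγ : IsPrimitiveRoot (γ : ZMod (p ^ p)) (Nat.totient (p ^ p))) {d : ℕ} (hd : 2 ≤ d)
    (hdp : d < p) : (p : ℤ) ^ p ∣ averageWeight p γ d := by
  obtain ⟨e, rfl⟩ : ∃ e, d = e + 1 := ⟨d - 1, by omega⟩
  rw [averageWeight_succ]
  refine Dvd.dvd.mul_left ?_ _
  have hcop : IsCoprime ((p : ℤ) ^ p) ((γ ^ (p ^ (p - 1))) ^ e - 1) := by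
    refine IsCoprime.pow_left ?_
    rw [(Nat.prime_iff_prime_int.mp hp).coprime_iff_not_dvd]
    exact not_dvd_teichmuller_pow_sub_one hp hγ (by omega) (by omega)
  refine hcop.dvd_of_dvd_mul_right ?_
  rw [geom_sum_mul, ← pow_mul, mul_comm e, pow_mul]
  refine (dvd_teichmuller_pow_sub_one hp hγ).trans ?_
  simpa using sub_dvd_pow_sub_pow ((γ ^ (p ^ (p - 1))) ^ (p - 1)) 1 e

end

/-! ### Homogeneity of words, passage to the quotient, and the formula -/

section

variable {Q : Type*} [AddCommGroup Q]

theorem evalWord_smul_left (M : Q →+ AddMonoid.End Q) (t : ℤ) (a y : Q) (w : FreeMagma Letter) :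
    evalWord (fun x z => M x z) (t • a) y w
      = t ^ countX w • evalWord (fun x z => M x z) a y w := by
  induction w with
  | ih1 l => cases l <;> simp [evalWord, countX]
  | ih2 u v hu hv =>
    change M (evalWord _ _ _ u) (evalWord _ _ _ v) =
      t ^ (countX u + countX v) • M (evalWord _ _ _ u) (evalWord _ _ _ v)
    rw [hu, hv, map_zsmul, map_zsmul, pow_add, mul_comm, mul_smul]
    rfl

theorem one_le_count (w : FreeMagma Letter) : 1 ≤ countX w + countY w := by
  induction w with
  | ih1 l => cases l <;> simp [countX, countY]
  | ih2 u v hu hv =>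
    change 1 ≤ countX u + countX v + (countY u + countY v)
    omega

/-- A word with `r` letters contains `r - 1` multiplications. -/
theorem evalWord_smul_op (M : Q →+ AddMonoid.End Q) (k : ℤ) (a y : Q) (w : FreeMagma Letter) :
    evalWord (fun x z => (k • M) x z) a y w
      = k ^ (countX w + countY w - 1) • evalWord (fun x z => M x z) a y w := by
  induction w with
  | ih1 l => cases l <;> simp [evalWord, countX, countY]
  | ih2 u v hu hv =>
    change k • M (evalWord _ _ _ u) (evalWord _ _ _ v) =
      k ^ (countX u + countX v + (countY u + countY v) - 1) •
        M (evalWord _ _ _ u) (evalWord _ _ _ v)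
    have h1 := one_le_count u
    have h2 := one_le_count v
    rw [hu, hv, map_zsmul, map_zsmul, show countX u + countX v + (countY u + countY v) - 1 =
      (countX v + countY v - 1) + (countX u + countY u - 1) + 1 by omega, pow_succ', pow_add,
      mul_smul, mul_smul]
    rfl

/-- A biadditive operation induces one on the quotient by a subgroup that absorbs products. -/
theorem exists_quotient_op {A : Type*} [AddCommGroup A] (M : A →+ AddMonoid.End A)
    (U : AddSubgroup A) (h1 : ∀ a, ∀ u ∈ U, M a u ∈ U) (h2 : ∀ u ∈ U, ∀ a, M u a ∈ U) :
    ∃ M' : (A ⧸ U) →+ AddMonoid.End (A ⧸ U), ∀ a b : A, M' a b = (M a b : A) := by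
  let f : A →+ AddMonoid.End (A ⧸ U) :=
    AddMonoidHom.mk' (fun a => QuotientAddGroup.map U U (M a) fun u hu => h1 a u hu)
      fun a b => by
        refine end_ext fun q => ?_
        induction q using QuotientAddGroup.induction_on with
        | H v =>
          change ((M (a + b) v : A) : A ⧸ U) = (M a v : A) + (M b v : A)
          rw [map_add]
          rfl
  refine ⟨QuotientAddGroup.lift U f fun u hu => ?_, fun a b => rfl⟩
  refine end_ext fun q => ?_
  induction q using QuotientAddGroup.induction_on with
  | H v => exact (QuotientAddGroup.eq_zero_iff _).mpr (h2 u hu v)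

theorem quotient_op_pow {A : Type*} [AddCommGroup A] {M : A →+ AddMonoid.End A}
    {U : AddSubgroup A} {M' : (A ⧸ U) →+ AddMonoid.End (A ⧸ U)}
    (h : ∀ a b : A, M' a b = (M a b : A)) (i : ℕ) (a b : A) :
    (M' a ^ i) (b : A ⧸ U) = ((M a ^ i) b : A) := by
  induction i with
  | zero => rfl
  | succ i ih => rw [pow_succ', end_mul_apply, ih, h, pow_succ']; rfl

theorem mem_ann {A : Type*} [AddCommGroup A] {m : ℕ} {a : A} : a ∈ ann A m ↔ m • a = 0 := Iff.rfl

end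

/-- On the quotient, `⊙` is given by a universal combination of words. -/
theorem LeftBrace.exists_quotient_flow {A : Type*} [AddCommGroup A] (B : LeftBrace A)
    {p n N m : ℕ} {c : ℕ → ℤ} (hm : p = m + 2) (hp : p.Prime) (hn : n < p)
    (hcard : Nat.card A = p ^ n) (hA : ∀ a : A, ((p : ℤ) ^ N) • a = 0)
    (hc : InvFactorial p N c) :
    ∃ M : (A ⧸ ann A (p ^ 2)) →+ AddMonoid.End (A ⧸ ann A (p ^ 2)), ∀ a y : A,
      (∃ z : A, p • z = B.star (p • a) y) ∧
      ∃ v : A ⧸ ann A (p ^ 2),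
        (a : A ⧸ ann A (p ^ 2)) =
          ∑ i ∈ range (m + 1), (c (i + 1) * (p : ℤ) ^ i) • (M v ^ i) v ∧
        ∀ z : A, p • z = B.star (p • a) y →
          (z : A ⧸ ann A (p ^ 2)) =
            ∑ i ∈ range (m + 1), (c (i + 1) * (p : ℤ) ^ i) •
              (M v ^ (i + 1)) (y : A ⧸ ann A (p ^ 2)) := by
  obtain ⟨M, hM⟩ := B.exists_flow_smul hp hn hcard hA hc
  rw [show p - 1 = m + 1 by omega] at hM
  obtain ⟨M', hM'⟩ := exists_quotient_op M (ann A (p ^ 2))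
    (fun a u hu => by
      rw [mem_ann] at hu ⊢
      rw [← map_nsmul, hu, map_zero])
    (fun u hu a => by
      rw [mem_ann] at hu ⊢
      have : (p ^ 2) • M u = 0 := by rw [← map_nsmul, hu, map_zero]
      exact DFunLike.congr_fun this a)
  refine ⟨M', fun a y => ?_⟩
  obtain ⟨v, hv, hstar⟩ := hM a
  refine ⟨⟨_, (hstar y).symm⟩, v, ?_, fun z hz => ?_⟩
  · conv_lhs => rw [hv]
    rw [← QuotientAddGroup.mk'_apply, map_sum]
    refine sum_congr rfl fun i _ => ?_
    rw [map_zsmul, QuotientAddGroup.mk'_apply, quotient_op_pow hM']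
  -- The equation for `p • z` determines `z` up to `ann(p)`, which lies in `ann(p ^ 2)`.
  · have hz' : (z : A ⧸ ann A (p ^ 2)) =
        (∑ i ∈ range (m + 1), (c (i + 1) * (p : ℤ) ^ i) • (M v ^ (i + 1)) y : A) := by
      rw [QuotientAddGroup.eq_iff_sub_mem, mem_ann, pow_two, mul_smul, smul_sub, hz, hstar,
        sub_self, smul_zero]
    rw [hz', ← QuotientAddGroup.mk'_apply, map_sum]
    refine sum_congr rfl fun i _ => ?_
    rw [map_zsmul, QuotientAddGroup.mk'_apply, quotient_op_pow hM']

theorem theorem11 (p n : ℕ) (hp : p.Prime) (hn : n < p - 1)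
    (A : Type*) [AddCommGroup A] (hA : Nat.card A = p ^ n) :
    ∃ α : wordsV →₀ ℤ,
      ∀ (γ : ℤ), IsPrimitiveRoot (γ : ZMod (p ^ p)) (Nat.totient (p ^ p)) →
      ∀ B : LeftBrace A,
        -- `⊙` is well defined: `(p a) * c` lies in `pA`, and `[a] ⊙ [c]` is the coset of any `z`
        -- with `p z = (p a) * c`, for all representatives `a`, `c`
        (∀ a c : A, ∃ z : A, p • z = B.star (p • a) c) ∧
        (∀ a c z : A, p • z = B.star (p • a) c →
          B.odot p (QuotientAddGroup.mk a) (QuotientAddGroup.mk c) = QuotientAddGroup.mk z) ∧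
        -- the formula
        (∀ a c : A,
          B.odot p (QuotientAddGroup.mk a) (QuotientAddGroup.mk c) =
            (-(∑ i ∈ Finset.range p, (p : ℤ) ^ i)) •
                B.bullet p γ (QuotientAddGroup.mk a) (QuotientAddGroup.mk c) +
              p • α.sum (fun w k => k •
                evalWord (B.bullet p γ) (QuotientAddGroup.mk a) (QuotientAddGroup.mk c)
                  (w : FreeMagma Letter))) := by
  obtain ⟨m, hm⟩ : ∃ m, p = m + 2 := ⟨p - 2, by have := hp.two_le; omega⟩
  have htors : ∀ a : A, (p ^ (p - 1)) • a = 0 := fun a => by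
    have h : (p ^ n) • a = 0 := hA ▸ card_nsmul_eq_zero'
    rw [show p - 1 = (p - 1 - n) + n by omega, pow_add, mul_smul, h, smul_zero]
  have htorsZ : ∀ a : A, ((p : ℤ) ^ (p - 1)) • a = 0 := fun a => by
    rw [← htors a, ← Nat.cast_pow, natCast_zsmul]
  have htorsQ : ∀ x : A ⧸ ann A (p ^ 2), (p ^ (p - 1)) • x = 0 := fun x => by
    induction x using QuotientAddGroup.induction_on with
    | H a => exact congrArg (QuotientAddGroup.mk' (ann A (p ^ 2))) (htors a)
  have hdvd : ∀ (k : ℤ) (x : A ⧸ ann A (p ^ 2)), (p : ℤ) ^ (p - 1) ∣ k → k • x = 0 := by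
    rintro _ x ⟨k, rfl⟩
    rw [mul_comm, mul_smul, ← Nat.cast_pow, natCast_zsmul, htorsQ, smul_zero]
  have hpp : (p : ℤ) ^ (p - 1) ∣ (p : ℤ) ^ p := pow_dvd_pow _ (Nat.sub_le _ _)
  obtain ⟨c, hc⟩ := exists_invFactorial hp (p - 1)
  obtain ⟨α, hα, hword⟩ := exists_uniform_coeff (p := p) (N := p - 1) (m := m)
    (A ⧸ ann A (p ^ 2)) hc.one htorsQ
  set κ : ℤ := -(∑ i ∈ Finset.range p, (p : ℤ) ^ i) with hκ
  have hκ1 : ∀ x : A ⧸ ann A (p ^ 2), κ • ((p : ℤ) - 1) • x = x := fun x => by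
    rw [smul_smul, hκ, neg_mul, geom_sum_mul, neg_sub, sub_smul, hdvd _ x hpp, one_smul, sub_zero]
  -- Rewriting `M` as `κ` times `•` multiplies a word of `V` by `κ ^ countX`, as its single `Y`
  -- makes `countX` the number of multiplications.
  refine ⟨Finsupp.onFinset α.support (fun w => κ ^ countX w.1 * α w) (fun w hw => by
    simp only [Finsupp.mem_support_iff]
    exact fun h => hw (by rw [h, mul_zero])), fun γ hγ B => ?_⟩
  obtain ⟨M, hM⟩ := B.exists_quotient_flow hm hp (by omega) hA htorsZ hc
  have hval : ∀ a y z : A, p • z = B.star (p • a) y → (z : A ⧸ ann A (p ^ 2)) =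
      M a y + p • α.sum fun w k => k • evalWord (fun x z => M x z)
        (a : A ⧸ ann A (p ^ 2)) (y : A ⧸ ann A (p ^ 2)) (w : FreeMagma Letter) := by
    intro a y z hz
    obtain ⟨-, v, hv, h⟩ := hM a y
    rw [h z hz, hword M a v y hv]
  have hodot : ∀ x y : A ⧸ ann A (p ^ 2), B.odot p x y =
      M x y + p • α.sum fun w k => k • evalWord (fun x z => M x z) x y
        (w : FreeMagma Letter) := by
    intro x y
    have hex := (hM (Quotient.out x) (Quotient.out y)).1
    have hz : p • pInv p (B.star (p • Quotient.out x) (Quotient.out y)) =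
        B.star (p • Quotient.out x) (Quotient.out y) := by
      rw [pInv, dif_pos hex]
      exact hex.choose_spec
    have := hval _ _ _ hz
    rwa [QuotientAddGroup.out_eq', QuotientAddGroup.out_eq'] at this
  have hbullet : ∀ x y : A ⧸ ann A (p ^ 2), B.bullet p γ x y = (((p : ℤ) - 1) • M) x y := by
    intro x y
    have e : B.bullet p γ x y = averageWeight p γ 1 • M x y + ∑ w ∈ α.support,
        ((p : ℤ) * α w * averageWeight p γ (countX w.1)) •
          evalWord (fun x z => M x z) x y w.1 := by
      simp only [averageWeight, sum_smul, mul_sum]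
      rw [sum_comm, ← sum_add_distrib]
      rw [LeftBrace.bullet]
      refine sum_congr rfl fun i _ => ?_
      rw [hodot, smul_add, map_zsmul]
      congr 1
      · rw [pow_one, mul_smul]; rfl
      · rw [Finsupp.sum, ← natCast_zsmul, smul_sum, smul_sum]
        refine sum_congr rfl fun w _ => ?_
        rw [evalWord_smul_left]
        simp only [smul_smul]
        congr 1
        ring
    rw [e, sum_eq_zero, add_zero]
    · have h1 := hdvd _ (M x y) (hpp.trans (averageWeight_one hp hγ))
      rw [sub_smul, sub_eq_zero] at h1
      rw [h1]
      rfl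
    · intro w _
      refine hdvd _ _ ?_
      have h2 : 2 ≤ countX w.1 := w.2.1
      -- Below degree `p` the average weight vanishes; from `p` on, `p * α w` is divisible by `p ^
      -- (countX - 1)`, hence by `p ^ (p - 1)`.
      rcases lt_or_ge (countX w.1) p with hlt | hge
      · exact (hpp.trans (dvd_averageWeight hp hγ h2 hlt)).mul_left _
      · refine Dvd.dvd.mul_right ?_ _
        have h3 := mul_dvd_mul_left (p : ℤ) (hα w)
        rw [← pow_succ'] at h3
        exact (pow_dvd_pow _ (by omega)).trans h3
  have hop : B.bullet p γ = fun x z => (((p : ℤ) - 1) • M) x z := by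
    funext x y
    exact hbullet x y
  have hMκ : M = κ • (((p : ℤ) - 1) • M) := by
    refine AddMonoidHom.ext fun x => end_ext fun y => ?_
    exact (hκ1 (M x y)).symm
  refine ⟨fun a y => (hM a y).1, fun a y z hz => ?_, fun a y => ?_⟩
  · rw [hval a y z hz]
    exact hodot a y
  · rw [hodot, hop, Finsupp.sum, Finsupp.onFinset_sum (g := fun (w : wordsV) (k : ℤ) =>
      k • evalWord (fun x z => (((p : ℤ) - 1) • M) x z) (a : A ⧸ ann A (p ^ 2))
        (y : A ⧸ ann A (p ^ 2)) w.1) _ (fun w => zero_smul ℤ _)]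
    congr 1
    · exact (hκ1 _).symm
    · congr 1
      refine sum_congr rfl fun w _ => ?_
      have h1 : countX w.1 + countY w.1 - 1 = countX w.1 := by
        have := w.2.2.1
        omega
      conv_lhs => rw [hMκ, evalWord_smul_op, h1, smul_smul, mul_comm]
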